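/- Let $K,\varepsilon,\delta,\alpha_0>0$ be fixed, and put $w=\sqrt{\frac{2}{2+\pi^2}}$. There are constants $C,R>0$, depending only on $K,\varepsilon,\delta,\alpha_0$, such that for all real $x,T,\alpha,\beta$ with $x\ge R$, $T\ge R$, $x^2\le KT$, $0\le\alpha<1+\varepsilon$ and $|\beta|<\sqrt T$ the sum $$S=\sum_{l\in\mathbb Z,\ l^2<Tx}(-1)^l e^{(\alpha+i\beta)\sqrt{x-\frac{l^2}{T}}}$$ satisfies the following. 1. If $\alpha=0$ or $\alpha\ge\alpha_0$, then $$|S|\le C\left(\sqrt{\frac{T}{|\beta|+1}}\;e^{\alpha\left(w+\delta\right)\sqrt x}+\sqrt T\right).$$ In particular, for every fixed $\alpha\ge 0$ this bound holds for all large $x,T$ with $x^2\le KT$, uniformly in $|\beta|<\sqrt T$. 2. For all $0\le\alpha<1+\varepsilon$, uniformly in $\alpha$, $$|S|\le C\left(\sqrt{\frac{T}{|\beta|+1}}\;e^{\left(\alpha w+\delta\right)\sqrt x}+\sqrt T\right).$$ -/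

import Mathlib

/-- The finite set of all integers `l` with `l ^ 2 < y`
(see `mem_integersWithSqLT`: the interval only serves to make finiteness visible). -/
noncomputable def integersWithSqLT (y : ℝ) : Finset ℤ :=
  (Finset.Icc (-⌈Real.sqrt y⌉) ⌈Real.sqrt y⌉).filter (fun l : ℤ => (l : ℝ) ^ 2 < y)

theorem mem_integersWithSqLT {y : ℝ} {l : ℤ} :
    l ∈ integersWithSqLT y ↔ (l : ℝ) ^ 2 < y := by
  unfold integersWithSqLT
  rw [Finset.mem_filter, Finset.mem_Icc]
  refine ⟨fun h => h.2, fun h => ⟨?_, h⟩⟩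
  have h1 : |(l : ℝ)| ≤ Real.sqrt y := Real.abs_le_sqrt h.le
  have h2 : Real.sqrt y ≤ (⌈Real.sqrt y⌉ : ℝ) := Int.le_ceil _
  have h3 := abs_le.mp (h1.trans h2)
  exact ⟨by exact_mod_cast h3.1, by exact_mod_cast h3.2⟩

/-- The sum of `(-1) ^ l * exp (s * √(x - l ^ 2 / T))` over all integers `l` with
`l ^ 2 < T * x`. -/
noncomputable def oscillatingSum (s : ℂ) (x T : ℝ) : ℂ :=
  ∑ l ∈ integersWithSqLT (T * x),
    (-1 : ℂ) ^ l * Complex.exp (s * (Real.sqrt (x - (l : ℝ) ^ 2 / T) : ℂ))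

/-! Write φ(l) = √(x - l²/T) and L = √(Tx). Apart from the sign, the phase β φ(l) has slope at most
|l| / (√T φ(l)) in absolute value, because |β| < √T. This is small near l = 0 and unbounded at the
edge l² = Tx. The sum is cut near l² = π²/(2+π²) · Tx, where φ = w√x and the slope bound equals
π/√2, safely below π.

Central part: the summand extends to an analytic function of exponential type less than π on a
vertical strip. For such f, the value f(n) is a mean, with kernel 1/cosh, of f over the lines re z =
n ± 1/2, so alternating signs cancel every line but the two outermost
(`exists_norm_alternating_sum_le`). With `norm_exp_mul_semicircleSqrt_le` this part is O(exp(α w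
√x)), although its individual terms reach exp(α √x).

Outer part: the amplitudes exp(α φ(l)) decrease from at most exp(α w √x), and partial summation
removes them. What remains has phase increments D of order |β| l / (Tφ), whose differences are of
order |β| x / (Tφ³), hence at least a constant times D³/L. On the k-th period of D, Kusmin–Landau
away from the stationary value and a trivial count near it give O(1 + √L (k+1)^(-3/2)). The second
term is summable over k, so the total is O(√L), uniformly in β
(`exists_norm_sum_le_sqrt_of_cubic_growth`).

Together |S| is O(exp(α w √x) (Tx)^(1/4)). Here T^(1/4) is at most a constant times √(T/(|β|+1)),
and x^(1/4) is absorbed by the δ in the exponent or, when α = 0, by √T through x² ≤ KT. -/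

/-! ### The Kusmin–Landau inequality -/

/-- The **Kusmin–Landau inequality** for a sequence whose ratios `z (l + 1) / z l` are encoded by a
monotone bounded real sequence `t` (a tangent of half the phase increment). -/
theorem norm_sum_le_of_monotone_tan {z : ℕ → ℂ} {t : ℕ → ℝ} {τ : ℝ} {a b : ℕ}
    (hτ : 0 ≤ τ) (hz : ∀ l, ‖z l‖ ≤ 1)
    (hzt : ∀ l, a ≤ l → l < b → z l = (z l - z (l + 1)) * (1 / 2 - Complex.I / 2 * t l))
    (ht : ∀ l, a ≤ l → l + 1 < b → t l ≤ t (l + 1))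
    (hbd : ∀ l, a ≤ l → l < b → |t l| ≤ τ) :
    ‖∑ l ∈ Finset.Ico a b, z l‖ ≤ 1 + 2 * τ := by
  rcases Nat.lt_or_ge a b with hab | hab
  swap
  · rw [Finset.Ico_eq_empty_of_le hab]; simp; linarith
  set g : ℕ → ℂ := fun l => 1 / 2 - Complex.I / 2 * t l with hg
  have hgn : ∀ l, a ≤ l → l < b → ‖g l‖ ≤ 1 / 2 + τ / 2 := by
    intro l h1 h2
    have := hbd l h1 h2
    calc ‖g l‖ ≤ ‖(1 / 2 : ℂ)‖ + ‖Complex.I / 2 * t l‖ := norm_sub_le _ _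
      _ = 1 / 2 + |t l| / 2 := by simp; ring
      _ ≤ _ := by linarith
  -- Abel summation: after the two boundary terms are removed, what is left is the sum of z (l + 1)
  -- (g (l + 1) - g l). Monotonicity of t makes the norms of these differences telescope.
  have key : ∀ m, a + m < b →
      ‖∑ l ∈ Finset.Ico a (a + m + 1), z l + z (a + m + 1) * g (a + m) - z a * g a‖
        ≤ (t (a + m) - t a) / 2 := by
    intro m
    induction m with
    | zero =>
      intro h
      have := hzt a le_rfl hab
      have h0 : z a + z (a + 1) * g a - z a * g a = 0 := by
        simp only [hg]; linear_combination this
      simp [h0]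
    | succ m ih =>
      intro h
      have h1 := ih (by omega)
      have h2 := hzt (a + m + 1) (by omega) (by omega)
      have h3 := ht (a + m) (by omega) (by omega)
      rw [Finset.sum_Ico_succ_top (by omega)]
      have e : (∑ l ∈ Finset.Ico a (a + (m + 1)), z l + z (a + (m + 1))) + z (a + (m + 1) + 1) * g (a + (m + 1)) - z a * g a
          = (∑ l ∈ Finset.Ico a (a + m + 1), z l + z (a + m + 1) * g (a + m) - z a * g a)
            + z (a + m + 1) * (g (a + m + 1) - g (a + m)) := by
        rw [show a + (m + 1) = a + m + 1 by ring]
        simp only [hg] at h2 ⊢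
        linear_combination h2
      rw [e]
      have h4 : ‖g (a + m + 1) - g (a + m)‖ = (t (a + m + 1) - t (a + m)) / 2 := by
        have : g (a + m + 1) - g (a + m) = -(Complex.I / 2) * ((t (a + m + 1) - t (a + m) : ℝ) : ℂ) := by
          simp only [hg]; push_cast; ring
        rw [this, norm_mul, Complex.norm_real, Real.norm_of_nonneg (by linarith)]
        simp; ring
      calc _ ≤ _ := norm_add_le _ _
        _ ≤ (t (a + m) - t a) / 2 + 1 * ((t (a + m + 1) - t (a + m)) / 2) := by
          rw [norm_mul, h4]
          gcongr
          exact hz _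
        _ = _ := by rw [show a + (m + 1) = a + m + 1 by ring]; ring
  obtain ⟨m, rfl⟩ : ∃ m, b = a + m + 1 := ⟨b - a - 1, by omega⟩
  have h1 := key m (by omega)
  have h2 := hgn a le_rfl hab
  have h3 := hgn (a + m) (by omega) (by omega)
  have h4 := abs_le.mp (hbd a le_rfl hab)
  have h5 := abs_le.mp (hbd (a + m) (by omega) (by omega))
  have e : ∑ l ∈ Finset.Ico a (a + m + 1), z l =
      (∑ l ∈ Finset.Ico a (a + m + 1), z l + z (a + m + 1) * g (a + m) - z a * g a)
        - z (a + m + 1) * g (a + m) + z a * g a := by ring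
  rw [e]
  have h6 : ‖z (a + m + 1) * g (a + m)‖ ≤ 1 * (1 / 2 + τ / 2) := by
    rw [norm_mul]; gcongr; exact hz _
  have h7 : ‖z a * g a‖ ≤ 1 * (1 / 2 + τ / 2) := by
    rw [norm_mul]; gcongr; exact hz _
  have h8 := norm_add_le ((∑ l ∈ Finset.Ico a (a + m + 1), z l + z (a + m + 1) * g (a + m) - z a * g a)
        - z (a + m + 1) * g (a + m)) (z a * g a)
  have h9 := norm_sub_le (∑ l ∈ Finset.Ico a (a + m + 1), z l + z (a + m + 1) * g (a + m) - z a * g a)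
        (z (a + m + 1) * g (a + m))
  linarith

/-- The half-angle identity `1 = (1 + e^{iD}) (1 - i tan (D/2)) / 2`. -/
theorem one_add_exp_mul_half_sub_tan {D : ℝ} (hD : Real.cos (D / 2) ≠ 0) :
    (1 + Complex.exp (D * Complex.I)) * (1 / 2 - Complex.I / 2 * (Real.tan (D / 2) : ℝ)) = 1 := by
  have h1 : Complex.exp (D * Complex.I) = Complex.exp (((D / 2 : ℝ) : ℂ) * Complex.I) ^ 2 := by
    rw [← Complex.exp_nat_mul]; congr 1; push_cast; ring
  have hc : (Real.cos (D / 2) : ℂ) ≠ 0 := by exact_mod_cast hD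
  have h2 : (Real.cos (D / 2) : ℂ) ^ 2 + (Real.sin (D / 2) : ℂ) ^ 2 = 1 := by
    exact_mod_cast Real.cos_sq_add_sin_sq (D / 2)
  rw [h1, Complex.exp_mul_I, ← Complex.ofReal_cos, ← Complex.ofReal_sin, Real.tan_eq_sin_div_cos,
    Complex.ofReal_div]
  set c := (Real.cos (D / 2) : ℂ)
  set s := (Real.sin (D / 2) : ℂ)
  have h3 : (1 + (c + s * Complex.I) ^ 2) = 2 * c * (c + s * Complex.I) := by
    linear_combination (-1 : ℂ) * h2 + s ^ 2 * Complex.I_sq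
  rw [h3]
  field_simp
  linear_combination h2 - s ^ 2 * Complex.I_sq

/-- Since tan y is the reciprocal of tan (π/2 - y), this is the inequality u < tan u at u = π/2 - y
≥ η/2. -/
theorem tan_half_pi_sub_le {η y : ℝ} (hη : 0 < η) (hy0 : 0 ≤ y) (hy : y ≤ Real.pi / 2 - η / 2) :
    Real.tan y ≤ 2 / η := by
  have h1 : 0 < Real.pi / 2 - y := by linarith
  rcases hy0.eq_or_lt with rfl | hy0
  · simp; positivity
  have h2 : Real.pi / 2 - y < Real.tan (Real.pi / 2 - y) := Real.lt_tan h1 (by linarith)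
  rw [Real.tan_pi_div_two_sub] at h2
  have h3 : 0 < Real.tan y := Real.tan_pos_of_pos_of_lt_pi_div_two hy0 (by linarith)
  rw [le_div_iff₀ hη]
  have h4 : η / 2 < (Real.tan y)⁻¹ := by linarith
  have := mul_lt_mul_of_pos_left h4 h3
  rw [mul_inv_cancel₀ h3.ne'] at this
  linarith

/-- **Kusmin–Landau inequality** for phase increments `π + D l` at distance `≥ η` from `2πℤ`. -/
theorem norm_sum_le_of_increments {z : ℕ → ℂ} {D : ℕ → ℝ} {η : ℝ} {a b : ℕ} (k : ℕ)
    (hη : 0 < η) (hz : ∀ l, ‖z l‖ ≤ 1)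
    (hzD : ∀ l, a ≤ l → l < b → z (l + 1) = -(Complex.exp (D l * Complex.I) * z l))
    (hD : ∀ l, a ≤ l → l + 1 < b → D l ≤ D (l + 1))
    (hlo : ∀ l, a ≤ l → l < b → 2 * Real.pi * k - Real.pi + η ≤ D l)
    (hhi : ∀ l, a ≤ l → l < b → D l ≤ 2 * Real.pi * k + Real.pi - η) :
    ‖∑ l ∈ Finset.Ico a b, z l‖ ≤ 1 + 4 / η := by
  -- Shifting by kπ brings D l / 2 into (-π/2, π/2), where tan is increasing.
  have htan : ∀ l, Real.tan (D l / 2) = Real.tan (D l / 2 - k * Real.pi) :=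
    fun l => (Real.tan_sub_nat_mul_pi _ _).symm
  have hcos : ∀ l, a ≤ l → l < b → Real.cos (D l / 2) ≠ 0 := by
    intro l h1 h2 h0
    have h3 : 0 < Real.cos (D l / 2 - k * Real.pi) := by
      apply Real.cos_pos_of_mem_Ioo
      constructor
      · have := hlo l h1 h2; linarith
      · have := hhi l h1 h2; linarith
    rw [Real.cos_sub_nat_mul_pi, h0] at h3
    simp at h3
  have := norm_sum_le_of_monotone_tan (z := z) (t := fun l => Real.tan (D l / 2)) (τ := 2 / η)
    (a := a) (b := b) (by positivity) hz ?_ ?_ ?_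
  · calc _ ≤ _ := this
      _ = _ := by ring
  · intro l h1 h2
    have h3 := one_add_exp_mul_half_sub_tan (hcos l h1 h2)
    rw [hzD l h1 h2]
    linear_combination (-z l) * h3
  · intro l h1 h2
    have h3 := hD l h1 h2
    have h4 := hlo l h1 (by omega)
    have h5 := hhi (l + 1) (by omega) h2
    simp only [htan]
    rcases h3.eq_or_lt with h | h
    · rw [h]
    · refine (Real.tan_lt_tan_of_lt_of_lt_pi_div_two ?_ ?_ ?_).le <;> linarith
  · intro l h1 h2
    have h4 := hlo l h1 h2
    have h5 := hhi l h1 h2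
    simp only [htan]
    rcases le_total 0 (D l / 2 - k * Real.pi) with h | h
    · rw [abs_of_nonneg (Real.tan_nonneg_of_nonneg_of_le_pi_div_two h (by linarith))]
      exact tan_half_pi_sub_le hη h (by linarith)
    · rw [← abs_neg, ← Real.tan_neg,
        abs_of_nonneg (Real.tan_nonneg_of_nonneg_of_le_pi_div_two (by linarith) (by linarith))]
      exact tan_half_pi_sub_le hη (by linarith) (by linarith)

/-! ### Level cuts, spacing and partial summation -/

/-- The points where a monotone sequence crosses given levels. -/
theorem exists_level_cuts {D : ℕ → ℝ} {a b : ℕ} (hab : a ≤ b)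
    (hD : ∀ l, a ≤ l → l + 1 < b → D l ≤ D (l + 1)) :
    ∃ c : ℝ → ℕ, Monotone c ∧ (∀ t, a ≤ c t) ∧ (∀ t, c t ≤ b) ∧
      (∀ t l, a ≤ l → l < c t → D l < t) ∧ (∀ t l, c t ≤ l → l < b → t ≤ D l) := by
  classical
  -- The cut at level t is the first index with t ≤ D n, or b if there is none.
  have hex : ∀ t : ℝ, ∃ n, a ≤ n ∧ (b ≤ n ∨ t ≤ D n) := fun t => ⟨b, hab, Or.inl le_rfl⟩
  refine ⟨fun t => Nat.find (hex t), ?_, fun t => (Nat.find_spec (hex t)).1,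
    fun t => Nat.find_min' (hex t) ⟨hab, Or.inl le_rfl⟩, ?_, ?_⟩
  · intro s t hst
    refine Nat.find_min' (hex s) ⟨(Nat.find_spec (hex t)).1, ?_⟩
    exact (Nat.find_spec (hex t)).2.imp_right hst.trans
  · intro t l h1 h2
    have := Nat.find_min (hex t) h2
    push Not at this
    exact (this h1).2
  · intro t l h1 h2
    have h3 := Nat.find_spec (hex t)
    replace h1 : Nat.find (hex t) ≤ l := h1
    induction l, h1 using Nat.le_induction with
    | base => exact h3.2.resolve_left (by omega)
    | succ l h ih => exact (ih (by omega)).trans (hD l (by omega) h2)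

/-- A sequence with increments at least `lam` stays few steps in an interval of length `2η`. -/
theorem length_le_of_spacing {D : ℕ → ℝ} {lam s η : ℝ} {a b : ℕ} (hη : 0 ≤ η) (hlam : 0 < lam)
    (hab : a ≤ b)
    (hD : ∀ l, a ≤ l → l + 1 < b → lam ≤ D (l + 1) - D l)
    (hlo : ∀ l, a ≤ l → l < b → s ≤ D l) (hhi : ∀ l, a ≤ l → l < b → D l < s + 2 * η) :
    (b : ℝ) - a ≤ 2 * η / lam + 1 := by
  rcases hab.eq_or_lt with rfl | hlt
  · simp; positivity
  have key : ∀ m, a + m < b → lam * m ≤ D (a + m) - D a := by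
    intro m
    induction m with
    | zero => intro; simp
    | succ m ih =>
      intro h
      have h1 := ih (by omega)
      have h2 := hD (a + m) (by omega) (by omega)
      rw [show a + (m + 1) = a + m + 1 by ring]
      push_cast; linarith
  obtain ⟨m, rfl⟩ : ∃ m, b = a + m + 1 := ⟨b - a - 1, by omega⟩
  have h1 := key m (by omega)
  have h2 := hlo a le_rfl hlt
  have h3 := hhi (a + m) (by omega) (by omega)
  push_cast
  have : (m : ℝ) ≤ 2 * η / lam := by rw [le_div_iff₀ hlam]; linarith
  linarith

theorem norm_sum_Ico_le_sub {z : ℕ → ℂ} (hz : ∀ l, ‖z l‖ ≤ 1) {a b : ℕ} (hab : a ≤ b) :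
    ‖∑ l ∈ Finset.Ico a b, z l‖ ≤ (b : ℝ) - a := by
  calc _ ≤ ∑ l ∈ Finset.Ico a b, ‖z l‖ := norm_sum_le _ _
    _ ≤ ∑ l ∈ Finset.Ico a b, (1 : ℝ) := Finset.sum_le_sum fun l _ => hz l
    _ = _ := by simp [Nat.cast_sub hab]

/-- Summation by parts against a nonnegative decreasing weight. -/
theorem norm_sum_mul_le_of_antitone {z : ℕ → ℂ} {A : ℕ → ℝ} {B : ℝ} {a b : ℕ} (hab : a < b)
    (hA : ∀ l, a ≤ l → l < b → 0 ≤ A l) (hmono : ∀ l, a ≤ l → l + 1 < b → A (l + 1) ≤ A l)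
    (hB : ∀ c, a ≤ c → c ≤ b → ‖∑ l ∈ Finset.Ico a c, z l‖ ≤ B) :
    ‖∑ l ∈ Finset.Ico a b, (A l : ℂ) * z l‖ ≤ A a * B := by
  have key : ∀ m, a + m < b →
      ‖∑ l ∈ Finset.Ico a (a + m + 1), (A l : ℂ) * z l
        - A (a + m) * ∑ l ∈ Finset.Ico a (a + m + 1), z l‖ ≤ (A a - A (a + m)) * B := by
    intro m
    induction m with
    | zero => intro; simp
    | succ m ih =>
      intro h
      have h1 := ih (by omega)
      have h2 := hmono (a + m) (by omega) (by omega)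
      have h3 := hB (a + m + 1) (by omega) (by omega)
      rw [show a + (m + 1) = a + m + 1 by ring, Finset.sum_Ico_succ_top (by omega : a ≤ a + m + 1),
        Finset.sum_Ico_succ_top (by omega : a ≤ a + m + 1)]
      set P := ∑ l ∈ Finset.Ico a (a + m + 1), (A l : ℂ) * z l
      set Q := ∑ l ∈ Finset.Ico a (a + m + 1), z l
      have e : P + A (a + m + 1) * z (a + m + 1) - A (a + m + 1) * (Q + z (a + m + 1))
          = (P - A (a + m) * Q) + ((A (a + m) - A (a + m + 1) : ℝ) : ℂ) * Q := by
        push_cast; ring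
      rw [e]
      calc _ ≤ _ := norm_add_le _ _
        _ ≤ (A a - A (a + m)) * B + (A (a + m) - A (a + m + 1)) * B := by
          rw [norm_mul, Complex.norm_real, Real.norm_of_nonneg (by linarith)]
          gcongr
        _ = _ := by ring
  obtain ⟨m, rfl⟩ : ∃ m, b = a + m + 1 := ⟨b - a - 1, by omega⟩
  have h1 := key m (by omega)
  have h2 := hB (a + m + 1) (by omega) le_rfl
  have h3 := hA (a + m) (by omega) (by omega)
  have h4 := norm_add_le (∑ l ∈ Finset.Ico a (a + m + 1), (A l : ℂ) * z l
        - A (a + m) * ∑ l ∈ Finset.Ico a (a + m + 1), z l)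
        (A (a + m) * ∑ l ∈ Finset.Ico a (a + m + 1), z l)
  rw [sub_add_cancel, norm_mul, Complex.norm_real, Real.norm_of_nonneg h3] at h4
  have h5 := mul_le_mul_of_nonneg_left h2 h3
  linarith

/-! ### A van der Corput bound under cubic growth -/

/-- A telescoping majorant for j^(-3/2), the weight with which the j-th period of the phase enters.
It makes the sum over periods bounded independently of their number. -/
theorem inv_mul_sqrt_le_telescope {j : ℝ} (hj : 1 ≤ j) :
    1 / (j * √j) ≤ 4 * (1 / √j - 1 / √(j + 1)) := by
  have h1 : 0 < √j := Real.sqrt_pos.mpr (by linarith)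
  have h2 : 0 < √(j + 1) := Real.sqrt_pos.mpr (by linarith)
  have e1 : √j ^ 2 = j := Real.sq_sqrt (by linarith)
  have e2 : √(j + 1) ^ 2 = j + 1 := Real.sq_sqrt (by linarith)
  have h3 : √(j + 1) ≤ 3 / 2 * √j := by
    apply Real.sqrt_le_iff.mpr
    constructor
    · positivity
    · nlinarith
  have e3 : 1 / √j - 1 / √(j + 1) = 1 / (√j * √(j + 1) * (√j + √(j + 1))) := by
    field_simp
    nlinarith
  rw [e3, mul_one_div, div_le_div_iff₀ (by positivity) (by positivity), one_mul]
  calc √j * √(j + 1) * (√j + √(j + 1)) ≤ √j * (3 / 2 * √j) * (√j + 3 / 2 * √j) := by gcongr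
    _ = 15 / 4 * (√j ^ 2 * √j) := by ring
    _ ≤ 4 * (√j ^ 2 * √j) := by gcongr; norm_num
    _ = _ := by rw [e1]

theorem sum_inv_mul_sqrt_le (K : ℕ) :
    ∑ k ∈ Finset.range K, 1 / (((k : ℝ) + 1) * √((k : ℝ) + 1)) ≤ 4 := by
  have : ∑ k ∈ Finset.range K, 1 / (((k : ℝ) + 1) * √((k : ℝ) + 1)) ≤ 4 * (1 - 1 / √((K : ℝ) + 1)) := by
    induction K with
    | zero => simp
    | succ K ih =>
      rw [Finset.sum_range_succ]
      have := inv_mul_sqrt_le_telescope (j := (K : ℝ) + 1) (by linarith [K.cast_nonneg (α := ℝ)])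
      push_cast
      linarith
  have h : 0 ≤ 1 / √((K : ℝ) + 1) := by positivity
  linarith

/-- A second-derivative test on one period: the phase increments `π + D l` have `D l` in
`[2πk, 2π(k+1))` and grow at rate at least `c (D l) ^ 3 / L`. -/
theorem norm_sum_one_period_le {c L : ℝ} (hc : 0 < c) {a b : ℕ} {z : ℕ → ℂ} {D : ℕ → ℝ}
    {r : ℝ → ℕ} (k : ℕ) (hk : ((k : ℝ) + 1) ^ 3 ≤ L) (hz : ∀ l, ‖z l‖ ≤ 1)
    (hzD : ∀ l, a ≤ l → l < b → z (l + 1) = -(Complex.exp (D l * Complex.I) * z l))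
    (hD : ∀ l, a ≤ l → l + 1 < b → c * D l ^ 3 / L ≤ D (l + 1) - D l)
    (hmono : ∀ l, a ≤ l → l + 1 < b → D l ≤ D (l + 1))
    (hr : Monotone r) (har : ∀ t, a ≤ r t) (hrb : ∀ t, r t ≤ b)
    (hlt : ∀ t l, a ≤ l → l < r t → D l < t) (hge : ∀ t l, r t ≤ l → l < b → t ≤ D l) :
    ‖∑ l ∈ Finset.Ico (r (2 * Real.pi * k)) (r (2 * Real.pi * (k + 1 : ℕ))), z l‖
      ≤ 3 + (8 + 2 / c) * √L * (1 / (((k : ℝ) + 1) * √((k : ℝ) + 1))) := by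
  have hpi := Real.pi_gt_three
  set j : ℝ := (k : ℝ) + 1 with hj
  have hj1 : 1 ≤ j := by rw [hj]; linarith [k.cast_nonneg (α := ℝ)]
  have hL1 : 1 ≤ L := le_trans (one_le_pow₀ hj1) hk
  have hsL : 0 < √L := Real.sqrt_pos.mpr (by linarith)
  have hsj : 0 < √j := Real.sqrt_pos.mpr (by linarith)
  have eL : √L ^ 2 = L := Real.sq_sqrt (by linarith)
  have ej : √j ^ 2 = j := Real.sq_sqrt (by linarith)
  -- This η balances the Kusmin–Landau cost 4/η against the length 2ηL/(c j³) of the window around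
  -- the stationary value 2πk + π. Both are of order √L j^(-3/2), and `hk` is what gives η ≤ 1.
  set η : ℝ := j * √j / √L with hη
  have hη0 : 0 < η := by positivity
  have hη1 : η ≤ 1 := by
    rw [hη, div_le_one hsL]
    apply Real.le_sqrt_of_sq_le
    rw [mul_pow, ej]; linarith
  set m₁ := r (2 * Real.pi * k + Real.pi - η) with hm1
  set m₂ := r (2 * Real.pi * k + Real.pi + η) with hm2
  set m₀ := r (2 * Real.pi * k) with hm0
  set m₃ := r (2 * Real.pi * (k + 1 : ℕ)) with hm3
  have h01 : m₀ ≤ m₁ := hr (by linarith)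
  have h12 : m₁ ≤ m₂ := hr (by linarith)
  have h23 : m₂ ≤ m₃ := hr (by push_cast; linarith)
  have ha0 : a ≤ m₀ := har _
  have h3b : m₃ ≤ b := hrb _
  have b1 : ‖∑ l ∈ Finset.Ico m₀ m₁, z l‖ ≤ 1 + 4 / η := by
    refine norm_sum_le_of_increments (D := D) k hη0 hz (fun l h1 h2 => hzD l (by omega) (by omega))
      (fun l h1 h2 => hmono l (by omega) (by omega)) (fun l h1 h2 => ?_) (fun l h1 h2 => ?_)
    · have := hge _ l h1 (by omega); linarith
    · exact (hlt _ l (by omega) h2).le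
  -- Past the stationary value, D l / 2 lies on the next branch of the tangent, hence `k + 1`.
  have b3 : ‖∑ l ∈ Finset.Ico m₂ m₃, z l‖ ≤ 1 + 4 / η := by
    refine norm_sum_le_of_increments (D := D) (k + 1) hη0 hz
      (fun l h1 h2 => hzD l (by omega) (by omega))
      (fun l h1 h2 => hmono l (by omega) (by omega)) (fun l h1 h2 => ?_) (fun l h1 h2 => ?_)
    · have := hge _ l h1 (by omega); push_cast; linarith
    · have := hlt _ l (by omega) h2; linarith
  have b2 : ‖∑ l ∈ Finset.Ico m₁ m₂, z l‖ ≤ 2 * η / (c * j ^ 3 / L) + 1 := by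
    refine (norm_sum_Ico_le_sub hz h12).trans ?_
    refine length_le_of_spacing (D := D) (s := 2 * Real.pi * k + Real.pi - η) hη0.le
      (by positivity) h12 (fun l h1 h2 => ?_) (fun l h1 h2 => hge _ l h1 (by omega))
      (fun l h1 h2 => ?_)
    · refine le_trans ?_ (hD l (by omega) (by omega))
      have h4 := hge _ l h1 (by omega)
      have : j ≤ D l := by
        rw [hj]
        nlinarith [k.cast_nonneg (α := ℝ)]
      gcongr
    · have := hlt _ l (by omega) h2; linarith
  have e1 : 4 / η = 4 * √L * (1 / (j * √j)) := by rw [hη]; field_simp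
  have e2 : 2 * η / (c * j ^ 3 / L) = 2 / c * √L * (1 / (j * √j)) := by
    rw [hη]; field_simp
    rw [ej, eL]
  rw [← Finset.sum_Ico_consecutive _ (h01.trans h12) h23, ← Finset.sum_Ico_consecutive _ h01 h12]
  have t1 := norm_add_le (∑ l ∈ Finset.Ico m₀ m₁, z l + ∑ l ∈ Finset.Ico m₁ m₂, z l)
    (∑ l ∈ Finset.Ico m₂ m₃, z l)
  have t2 := norm_add_le (∑ l ∈ Finset.Ico m₀ m₁, z l) (∑ l ∈ Finset.Ico m₁ m₂, z l)
  rw [e1] at b1 b3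
  rw [e2] at b2
  linarith

/-- A van der Corput bound for phase increments `π + D l` where `D l ≥ 0` grows at rate at least
`c₁ (D l) ^ 3 / L`, and where at most `c₂ L / (D l) ^ 2` terms follow the `l`-th one. -/
theorem exists_norm_sum_le_sqrt_of_cubic_growth {c₁ c₂ : ℝ} (hc₁ : 0 < c₁) (hc₂ : 0 ≤ c₂) :
    ∃ C : ℝ, 0 < C ∧ ∀ (L : ℝ) (a b : ℕ) (z : ℕ → ℂ) (D : ℕ → ℝ), 1 ≤ L → a ≤ b →
      (∀ l, ‖z l‖ ≤ 1) →
      (∀ l, a ≤ l → l < b → z (l + 1) = -(Complex.exp (D l * Complex.I) * z l)) →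
      (∀ l, a ≤ l → l < b → 0 ≤ D l) →
      (∀ l, a ≤ l → l + 1 < b → c₁ * D l ^ 3 / L ≤ D (l + 1) - D l) →
      (∀ l, a ≤ l → l < b → ((b : ℝ) - l) * D l ^ 2 ≤ c₂ * L) →
      ‖∑ l ∈ Finset.Ico a b, z l‖ ≤ C * √L := by
  refine ⟨3 + 4 * (8 + 2 / c₁) + 4 * c₂, by positivity, ?_⟩
  intro L a b z D hL hab hz hzD hD0 hD htail
  have hpi := Real.pi_gt_three
  have hmono : ∀ l, a ≤ l → l + 1 < b → D l ≤ D (l + 1) := by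
    intro l h1 h2
    have h3 := hD l h1 h2
    have h4 := hD0 l h1 (by omega)
    have : 0 ≤ c₁ * D l ^ 3 / L := by positivity
    linarith
  obtain ⟨r, hr, har, hrb, hlt, hge⟩ := exists_level_cuts hab hmono
  have hr0 : r 0 = a := by
    by_contra h
    have h1 : a < r 0 := lt_of_le_of_ne (har 0) (Ne.symm h)
    exact absurd (hlt 0 a le_rfl h1) (not_lt.mpr (hD0 a le_rfl (h1.trans_le (hrb 0))))
  have hs1 : 1 ≤ √L := Real.one_le_sqrt.mpr hL
  have hss1 : 1 ≤ √(√L) := Real.one_le_sqrt.mpr hs1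
  have es : √(√L) ^ 2 = √L := Real.sq_sqrt (by linarith)
  have eL : √L ^ 2 = L := Real.sq_sqrt (by linarith)
  -- About L^(1/4) periods are treated one by one, so their additive constants 3 total at most 3√L.
  -- Beyond them D is at least √(√L)/2, and `htail` leaves only O(√L) terms, which are counted
  -- trivially.
  set K : ℕ := ⌊√(√L)⌋₊ with hK
  have hK1 : 1 ≤ K := Nat.le_floor (by simpa using hss1)
  have hK1' : (1 : ℝ) ≤ K := by exact_mod_cast hK1
  have hKle : (K : ℝ) ≤ √(√L) := Nat.floor_le (by positivity)
  have hKlt : √(√L) < K + 1 := Nat.lt_floor_add_one _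
  have hper : ∀ n, n ≤ K → ‖∑ l ∈ Finset.Ico (r (2 * Real.pi * (0 : ℕ))) (r (2 * Real.pi * n)), z l‖
      ≤ ∑ k ∈ Finset.range n, (3 + (8 + 2 / c₁) * √L * (1 / (((k : ℝ) + 1) * √((k : ℝ) + 1)))) := by
    intro n
    induction n with
    | zero => intro; simp
    | succ n ih =>
      intro hn
      have h1 := ih (by omega)
      have h2 : ((n : ℝ) + 1) ^ 3 ≤ L := by
        have h3 : (n : ℝ) + 1 ≤ √(√L) := le_trans (by exact_mod_cast hn) hKle
        calc ((n : ℝ) + 1) ^ 3 ≤ √(√L) ^ 3 := by gcongr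
          _ ≤ √(√L) ^ 4 := pow_le_pow_right₀ hss1 (by norm_num)
          _ = (√(√L) ^ 2) ^ 2 := by ring
          _ = L := by rw [es, eL]
      have h4 := norm_sum_one_period_le hc₁ n h2 hz hzD hD hmono hr har hrb hlt hge
      rw [Finset.sum_range_succ, ← Finset.sum_Ico_consecutive _
        (hr (by simp; positivity) : r (2 * Real.pi * (0 : ℕ)) ≤ r (2 * Real.pi * n))
        (hr (by push_cast; nlinarith) : r (2 * Real.pi * n) ≤ r (2 * Real.pi * (n + 1 : ℕ)))]
      exact (norm_add_le _ _).trans (add_le_add h1 h4)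
  have h1 := hper K le_rfl
  simp only [Nat.cast_zero, mul_zero, hr0] at h1
  rw [Finset.sum_add_distrib, ← Finset.mul_sum] at h1
  have h2 := sum_inv_mul_sqrt_le K
  have h3 : (8 + 2 / c₁) * √L * ∑ k ∈ Finset.range K, 1 / (((k : ℝ) + 1) * √((k : ℝ) + 1))
      ≤ (8 + 2 / c₁) * √L * 4 := by gcongr
  have h4 : ∑ k ∈ Finset.range K, (3 : ℝ) ≤ 3 * √L := by
    simp only [Finset.sum_const, Finset.card_range, nsmul_eq_mul]
    nlinarith
  have h5 : ‖∑ l ∈ Finset.Ico (r (2 * Real.pi * K)) b, z l‖ ≤ 4 * c₂ * √L := by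
    refine (norm_sum_Ico_le_sub hz (hrb _)).trans ?_
    rcases (hrb (2 * Real.pi * K)).eq_or_lt with h | h
    · rw [h]; simp; positivity
    have h6 := hge _ _ le_rfl h
    have h7 := htail _ (har _) h
    set l₀ := r (2 * Real.pi * K)
    have h8 : √(√L) / 2 ≤ D l₀ := by nlinarith
    have h9 : √L / 4 ≤ D l₀ ^ 2 := by
      calc √L / 4 = (√(√L) / 2) ^ 2 := by rw [div_pow, es]; norm_num
        _ ≤ _ := by gcongr
    have h10 : (0 : ℝ) ≤ (b : ℝ) - l₀ := by
      have : (l₀ : ℝ) ≤ b := by exact_mod_cast h.le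
      linarith
    have h11 : ((b : ℝ) - l₀) * (√L / 4) ≤ c₂ * √L ^ 2 := by
      rw [eL]; exact (mul_le_mul_of_nonneg_left h9 h10).trans h7
    have h12 : ((b : ℝ) - l₀) * √L ≤ (4 * c₂ * √L) * √L := by linarith
    exact le_of_mul_le_mul_right h12 (by linarith)
  rw [← Finset.sum_Ico_consecutive _ (har (2 * Real.pi * K)) (hrb _)]
  refine (norm_add_le _ _).trans ?_
  linarith

/-! ### Alternating sums of analytic functions via the kernel 1/cosh -/

theorem integrable_exp_neg_mul_abs {c : ℝ} (hc : 0 < c) :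
    MeasureTheory.Integrable (fun v : ℝ => Real.exp (-(c * |v|))) := by
  rw [← MeasureTheory.integrableOn_univ, ← Set.Iic_union_Ioi (a := (0 : ℝ))]
  refine MeasureTheory.IntegrableOn.union ?_ ?_
  · refine (integrableOn_exp_mul_Iic hc 0).congr_fun (fun v hv => ?_) measurableSet_Iic
    simp [abs_of_nonpos (Set.mem_Iic.mp hv)]
  · refine (integrableOn_exp_mul_Ioi (neg_lt_zero.mpr hc) 0).congr_fun (fun v hv => ?_)
      measurableSet_Ioi
    simp [abs_of_pos (Set.mem_Ioi.mp hv)]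

theorem exp_mul_abs_le_two_mul_cosh {c : ℝ} (hc : 0 ≤ c) (v : ℝ) :
    Real.exp (c * |v|) ≤ 2 * Real.cosh (c * v) := by
  have h : Real.cosh (c * v) = Real.cosh (c * |v|) := by
    rw [← Real.cosh_abs (c * v), abs_mul, abs_of_nonneg hc]
  rw [h, Real.cosh_eq]
  linarith [Real.exp_pos (-(c * |v|))]

theorem norm_div_cosh_le {θ M : ℝ} {g : ℝ → ℂ} (hM : 0 ≤ M)
    (hb : ∀ v, ‖g v‖ ≤ M * Real.exp (θ * |v|)) (v : ℝ) :
    ‖g v / (Real.cosh (Real.pi * v) : ℂ)‖ ≤ M * (2 * Real.exp (-((Real.pi - θ) * |v|))) := by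
  have h1 := exp_mul_abs_le_two_mul_cosh Real.pi_pos.le v
  have h2 := Real.cosh_pos (Real.pi * v)
  rw [norm_div, Complex.norm_real, Real.norm_of_nonneg h2.le, div_le_iff₀ h2]
  have h3 : Real.exp (-((Real.pi - θ) * |v|)) * Real.exp (Real.pi * |v|) = Real.exp (θ * |v|) := by
    rw [← Real.exp_add]; congr 1; ring
  calc ‖g v‖ ≤ M * Real.exp (θ * |v|) := hb v
    _ = M * Real.exp (-((Real.pi - θ) * |v|)) * Real.exp (Real.pi * |v|) := by rw [← h3]; ring
    _ ≤ M * Real.exp (-((Real.pi - θ) * |v|)) * (2 * Real.cosh (Real.pi * v)) := by gcongr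
    _ = _ := by ring

theorem integrable_div_cosh {θ M : ℝ} {g : ℝ → ℂ} (hθ : θ < Real.pi) (hM : 0 ≤ M)
    (hg : Continuous g) (hb : ∀ v, ‖g v‖ ≤ M * Real.exp (θ * |v|)) :
    MeasureTheory.Integrable (fun v => g v / (Real.cosh (Real.pi * v) : ℂ)) := by
  refine (((integrable_exp_neg_mul_abs (sub_pos.mpr hθ)).const_mul 2).const_mul M).mono' ?_
    (Filter.Eventually.of_forall (norm_div_cosh_le hM hb))
  refine (hg.div ?_ fun v => ?_).aestronglyMeasurable
  · exact Complex.continuous_ofReal.comp (Real.continuous_cosh.comp (by fun_prop))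
  · exact_mod_cast (Real.cosh_pos _).ne'

theorem norm_integral_div_cosh_le {θ M : ℝ} {g : ℝ → ℂ} (hθ : θ < Real.pi) (hM : 0 ≤ M)
    (hb : ∀ v, ‖g v‖ ≤ M * Real.exp (θ * |v|)) :
    ‖∫ v, g v / (Real.cosh (Real.pi * v) : ℂ)‖
      ≤ M * ∫ v : ℝ, 2 * Real.exp (-((Real.pi - θ) * |v|)) := by
  rw [← MeasureTheory.integral_const_mul]
  exact MeasureTheory.norm_integral_le_of_norm_le
    (((integrable_exp_neg_mul_abs (sub_pos.mpr hθ)).const_mul 2).const_mul M)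
    (Filter.Eventually.of_forall (norm_div_cosh_le hM hb))

theorem integral_inv_cosh_pos : 0 < ∫ v : ℝ, 1 / Real.cosh (Real.pi * v) := by
  have hint : MeasureTheory.Integrable (fun v : ℝ => 1 / Real.cosh (Real.pi * v)) := by
    have := (integrable_div_cosh (θ := 0) (M := 1) (g := fun _ => 1) Real.pi_pos zero_le_one
      continuous_const (by simp)).re
    refine this.congr (Filter.Eventually.of_forall fun v => ?_)
    simp only [RCLike.re_to_complex]
    rw [← Complex.ofReal_one, ← Complex.ofReal_div, Complex.ofReal_re]
  rw [MeasureTheory.integral_pos_iff_support_of_nonneg (fun v => by positivity) hint]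
  have : Function.support (fun v : ℝ => 1 / Real.cosh (Real.pi * v)) = Set.univ := by
    ext v; simp [(Real.cosh_pos (Real.pi * v)).ne']
  rw [this]; simp

theorem sin_pi_mul_ne_zero_of_abs_re_le {z : ℂ} (hre : |z.re| ≤ 1 / 2) (hz : z ≠ 0) :
    Complex.sin (Real.pi * z) ≠ 0 := by
  intro h
  obtain ⟨k, hk⟩ := Complex.sin_eq_zero_iff.mp h
  have hpi : (Real.pi : ℂ) ≠ 0 := by exact_mod_cast Real.pi_ne_zero
  have hk' : z = k := mul_left_cancel₀ hpi (by rw [hk]; ring)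
  rw [hk'] at hre hz
  simp only [Complex.intCast_re] at hre
  have : |k| < 1 := by
    have : (|k| : ℝ) < 1 := by linarith
    exact_mod_cast this
  rw [Int.abs_lt_one_iff] at this
  simp [this] at hz

/-- From |sin z|² = sin²(re z) + sinh²(im z). It makes 1/sin(πz) small on distant horizontal edges.
-/
theorem abs_sinh_im_le_norm_sin (z : ℂ) : |Real.sinh z.im| ≤ ‖Complex.sin z‖ := by
  have h : Complex.normSq (Complex.sin z) = Real.sin z.re ^ 2 + Real.sinh z.im ^ 2 := by
    rw [Complex.sin_eq z, Complex.normSq_apply]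
    simp only [Complex.add_re, Complex.mul_re, Complex.add_im, Complex.mul_im, Complex.I_re,
      Complex.I_im, ← Complex.ofReal_sin, ← Complex.ofReal_cos, ← Complex.ofReal_cosh,
      ← Complex.ofReal_sinh, Complex.ofReal_re, Complex.ofReal_im]
    linear_combination Real.sinh z.im ^ 2 * Real.sin_sq_add_cos_sq z.re +
      Real.sin z.re ^ 2 * Real.cosh_sq z.im
  rw [← Real.sqrt_sq_eq_abs, Complex.norm_def, h]
  exact Real.sqrt_le_sqrt (by nlinarith [sq_nonneg (Real.sin z.re)])

/-- For a function that is analytic and of exponential type less than `π` on the strip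
`|re z| ≤ 1/2`, the value at the centre is a weighted mean of the values on the two edges. -/
theorem integral_edges_div_cosh {f : ℂ → ℂ} {U : Set ℂ} {θ M : ℝ} (hU : IsOpen U)
    (hUs : ∀ z : ℂ, |z.re| ≤ 1 / 2 → z ∈ U) (hf : DifferentiableOn ℂ f U)
    (hθ0 : 0 ≤ θ) (hθ : θ < Real.pi) (hM : 0 ≤ M)
    (hb : ∀ z : ℂ, |z.re| ≤ 1 / 2 → ‖f z‖ ≤ M * Real.exp (θ * |z.im|)) :
    (∫ v : ℝ, f ((1 / 2 : ℝ) + v * Complex.I) / (Real.cosh (Real.pi * v) : ℂ)) +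
      (∫ v : ℝ, f ((-(1 / 2) : ℝ) + v * Complex.I) / (Real.cosh (Real.pi * v) : ℂ))
      = 2 * ((∫ v : ℝ, 1 / Real.cosh (Real.pi * v) : ℝ) : ℂ) * f 0 := by
  have hline : ∀ c : ℝ, |c| ≤ 1 / 2 → Continuous fun v : ℝ => f ((c : ℂ) + v * Complex.I) := by
    intro c hc
    refine hf.continuousOn.comp_continuous (by fun_prop) fun v => hUs _ (by simpa using hc)
  have hlb : ∀ c : ℝ, |c| ≤ 1 / 2 → ∀ v : ℝ, ‖f ((c : ℂ) + v * Complex.I)‖ ≤ M * Real.exp (θ * |v|) := by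
    intro c hc v
    simpa using hb ((c : ℂ) + v * Complex.I) (by simpa using hc)
  have hr : |(1 / 2 : ℝ)| ≤ 1 / 2 := by norm_num [abs_of_pos]
  have hl : |(-(1 / 2) : ℝ)| ≤ 1 / 2 := by rw [abs_neg]; exact hr
  have i1 := integrable_div_cosh hθ hM (hline _ hr) (hlb _ hr)
  have i2 := integrable_div_cosh hθ hM (hline _ hl) (hlb _ hl)
  have i3 := integrable_div_cosh (g := fun _ => 1) Real.pi_pos zero_le_one continuous_const (by simp)
  -- H is (f z - f 0) / sin (πz) with the singularity at 0 removed, so Cauchy's theorem on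
  -- rectangles applies without residues. On the edges re z = ±1/2 the sine is ±cosh (πv), and the
  -- subtracted f 0 yields the right-hand side.
  set H : ℂ → ℂ := fun z => dslope f 0 z / dslope (fun z => Complex.sin (Real.pi * z)) 0 z with hH
  have hsind : Differentiable ℂ fun z : ℂ => Complex.sin (Real.pi * z) := by fun_prop
  have hderiv : deriv (fun z : ℂ => Complex.sin (Real.pi * z)) 0 = Real.pi := by
    have : HasDerivAt (fun z : ℂ => Complex.sin (Real.pi * z)) (Complex.cos (Real.pi * 0) * (Real.pi * 1)) 0 :=
      ((hasDerivAt_id (0 : ℂ)).const_mul (Real.pi : ℂ)).csin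
    rw [this.deriv]; simp
  have hne : ∀ z : ℂ, |z.re| ≤ 1 / 2 → dslope (fun z => Complex.sin (Real.pi * z)) 0 z ≠ 0 := by
    intro z hz
    rcases eq_or_ne z 0 with rfl | h0
    · rw [dslope_same, hderiv]; exact_mod_cast Real.pi_ne_zero
    · rw [dslope_of_ne _ h0, slope_def_field]
      simpa [h0] using sin_pi_mul_ne_zero_of_abs_re_le hz h0
  have hHd : DifferentiableOn ℂ H {z : ℂ | |z.re| ≤ 1 / 2} := by
    refine DifferentiableOn.div ?_ ?_ hne
    · exact ((Complex.differentiableOn_dslope (hU.mem_nhds (hUs 0 (by simp)))).mpr hf).mono hUs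
    · exact ((Complex.differentiableOn_dslope Filter.univ_mem).mpr hsind.differentiableOn).mono
        (Set.subset_univ _)
  have hHv : ∀ z : ℂ, z ≠ 0 → H z = (f z - f 0) / Complex.sin (Real.pi * z) := by
    intro z hz
    simp only [hH, dslope_of_ne _ hz, slope_def_field, mul_zero, Complex.sin_zero, sub_zero]
    field_simp
  have hsinr : ∀ v : ℝ, Complex.sin (Real.pi * (((1 / 2 : ℝ) : ℂ) + v * Complex.I))
      = (Real.cosh (Real.pi * v) : ℂ) := by
    intro v
    rw [show (Real.pi : ℂ) * (((1 / 2 : ℝ) : ℂ) + v * Complex.I)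
      = ((Real.pi * v : ℝ) : ℂ) * Complex.I + Real.pi / 2 by push_cast; ring, Complex.sin_add_pi_div_two,
      Complex.cos_mul_I, Complex.ofReal_cosh]
  have hsinl : ∀ v : ℝ, Complex.sin (Real.pi * (((-(1 / 2) : ℝ) : ℂ) + v * Complex.I))
      = -(Real.cosh (Real.pi * v) : ℂ) := by
    intro v
    rw [show (Real.pi : ℂ) * (((-(1 / 2) : ℝ) : ℂ) + v * Complex.I)
      = ((Real.pi * v : ℝ) : ℂ) * Complex.I - Real.pi / 2 by push_cast; ring, Complex.sin_sub_pi_div_two,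
      Complex.cos_mul_I, Complex.ofReal_cosh]
  have hHr : ∀ v : ℝ, H (((1 / 2 : ℝ) : ℂ) + v * Complex.I)
      = f (((1 / 2 : ℝ) : ℂ) + v * Complex.I) / (Real.cosh (Real.pi * v) : ℂ)
        - f 0 * (1 / (Real.cosh (Real.pi * v) : ℂ)) := by
    intro v
    rw [hHv _ (fun h => by simpa using congrArg Complex.re h), hsinr]
    ring
  have hHl : ∀ v : ℝ, H (((-(1 / 2) : ℝ) : ℂ) + v * Complex.I)
      = -(f (((-(1 / 2) : ℝ) : ℂ) + v * Complex.I) / (Real.cosh (Real.pi * v) : ℂ)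
        - f 0 * (1 / (Real.cosh (Real.pi * v) : ℂ))) := by
    intro v
    rw [hHv _ (fun h => by simpa using congrArg Complex.re h), hsinl]
    rw [div_neg]; ring
  have hrect : ∀ h : ℝ,
      Complex.I * ((∫ y in (-h)..h, H (((1 / 2 : ℝ) : ℂ) + y * Complex.I))
        - ∫ y in (-h)..h, H (((-(1 / 2) : ℝ) : ℂ) + y * Complex.I))
      = (∫ t in (-(1 / 2) : ℝ)..(1 / 2), H (t + h * Complex.I))
        - ∫ t in (-(1 / 2) : ℝ)..(1 / 2), H (t + (-h : ℝ) * Complex.I) := by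
    intro h
    have := Complex.integral_boundary_rect_eq_zero_of_differentiableOn H
      (⟨-(1 / 2), -h⟩ : ℂ) (⟨1 / 2, h⟩ : ℂ) (hHd.mono ?_)
    · simp only [smul_eq_mul] at this
      linear_combination this
    · intro z hz
      rw [Complex.mem_reProdIm] at hz
      have h1 := hz.1
      simp only at h1
      rw [Set.uIcc_of_le (by norm_num)] at h1
      exact abs_le.mpr h1
  -- The bound 2M exp(θh) / sinh(πh) for the horizontal edges at height ±h tends to 0 because θ < π.
  have hsinh : Filter.Tendsto (fun h : ℝ => 4 * M * Real.exp (-((Real.pi - θ) * h)) / (1 - Real.exp (-(2 * Real.pi * h))))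
      Filter.atTop (nhds (4 * M * 0 / (1 - 0))) := by
    have e1 : Filter.Tendsto (fun h : ℝ => Real.exp (-((Real.pi - θ) * h))) Filter.atTop (nhds 0) :=
      Real.tendsto_exp_neg_atTop_nhds_zero.comp
        (Filter.tendsto_id.const_mul_atTop (sub_pos.mpr hθ))
    have e2 : Filter.Tendsto (fun h : ℝ => Real.exp (-(2 * Real.pi * h))) Filter.atTop (nhds 0) :=
      Real.tendsto_exp_neg_atTop_nhds_zero.comp
        (Filter.tendsto_id.const_mul_atTop (by positivity))
    exact (e1.const_mul (4 * M)).div (tendsto_const_nhds.sub e2) (by norm_num)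
  rw [mul_zero, zero_div] at hsinh
  have htop : ∀ h : ℝ, 0 < h → ∀ ε : ℝ, |ε| = h →
      ‖∫ t in (-(1 / 2) : ℝ)..(1 / 2), H (t + ε * Complex.I)‖
        ≤ 4 * M * Real.exp (-((Real.pi - θ) * h)) / (1 - Real.exp (-(2 * Real.pi * h))) := by
    intro h hh ε hε
    have hε0 : ε ≠ 0 := by rintro rfl; simp at hε; linarith
    have hlt : Real.exp (-(2 * Real.pi * h)) < 1 := Real.exp_lt_one_iff.mpr (by nlinarith [Real.pi_pos])
    have := intervalIntegral.norm_integral_le_of_norm_le_const (a := -(1 / 2)) (b := 1 / 2)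
      (f := fun t : ℝ => H (t + ε * Complex.I))
      (C := 4 * M * Real.exp (-((Real.pi - θ) * h)) / (1 - Real.exp (-(2 * Real.pi * h)))) ?_
    · refine this.trans_eq ?_
      norm_num
    intro t ht
    rw [Set.uIoc_of_le (by norm_num)] at ht
    have hre : |((t : ℂ) + ε * Complex.I).re| ≤ 1 / 2 := by
      simpa using abs_le.mpr ⟨ht.1.le, ht.2⟩
    have him : ((t : ℂ) + ε * Complex.I).im = ε := by simp
    have hz0 : (t : ℂ) + ε * Complex.I ≠ 0 := fun h0 => hε0 (by rw [← him, h0]; simp)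
    have hb1 := hb _ hre
    have hb0 := hb 0 (by simp)
    have hs := abs_sinh_im_le_norm_sin (Real.pi * ((t : ℂ) + ε * Complex.I))
    rw [him, hε] at hb1
    have e3 : (Real.pi * ((t : ℂ) + ε * Complex.I)).im = Real.pi * ε := by simp
    rw [e3, Real.abs_sinh, abs_mul, hε, abs_of_pos Real.pi_pos, Real.sinh_eq] at hs
    have hs' : Real.exp (Real.pi * h) * (1 - Real.exp (-(2 * Real.pi * h))) / 2
        ≤ ‖Complex.sin (Real.pi * ((t : ℂ) + ε * Complex.I))‖ := by
      refine le_trans (le_of_eq ?_) hs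
      rw [mul_sub, ← Real.exp_add, mul_one]; congr 3; ring
    have hpos : 0 < Real.exp (Real.pi * h) * (1 - Real.exp (-(2 * Real.pi * h))) / 2 := by
      have := Real.exp_pos (Real.pi * h)
      have : 0 < 1 - Real.exp (-(2 * Real.pi * h)) := by linarith
      positivity
    have hnum : ‖f ((t : ℂ) + ε * Complex.I) - f 0‖ ≤ 2 * (M * Real.exp (θ * h)) := by
      have : M * Real.exp (θ * |(0 : ℂ).im|) ≤ M * Real.exp (θ * h) := by
        simp only [Complex.zero_im, abs_zero]; gcongr
      linarith [norm_sub_le (f ((t : ℂ) + ε * Complex.I)) (f 0)]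
    rw [hHv _ hz0, norm_div]
    calc _ ≤ 2 * (M * Real.exp (θ * h)) / (Real.exp (Real.pi * h) * (1 - Real.exp (-(2 * Real.pi * h))) / 2) := by
          gcongr
      _ = _ := by
          have : Real.exp (θ * h) = Real.exp (-((Real.pi - θ) * h)) * Real.exp (Real.pi * h) := by
            rw [← Real.exp_add]; congr 1; ring
          rw [this]
          have h5 : 1 - Real.exp (-(2 * Real.pi * h)) ≠ 0 := by linarith
          field_simp
          ring
  have hlim0 : Filter.Tendsto (fun h : ℝ => (∫ t in (-(1 / 2) : ℝ)..(1 / 2), H (t + h * Complex.I))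
        - ∫ t in (-(1 / 2) : ℝ)..(1 / 2), H (t + (-h : ℝ) * Complex.I)) Filter.atTop (nhds 0) := by
    rw [← sub_zero (0 : ℂ)]
    refine Filter.Tendsto.sub ?_ ?_
    · refine squeeze_zero_norm' ?_ hsinh
      filter_upwards [Filter.eventually_gt_atTop 0] with h hh
      exact htop h hh h (abs_of_pos hh)
    · refine squeeze_zero_norm' ?_ hsinh
      filter_upwards [Filter.eventually_gt_atTop 0] with h hh
      exact htop h hh (-h) (by rw [abs_neg, abs_of_pos hh])
  have hir : MeasureTheory.Integrable fun v : ℝ => H (((1 / 2 : ℝ) : ℂ) + v * Complex.I) := by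
    simp only [hHr]; exact i1.sub (i3.const_mul _)
  have hil : MeasureTheory.Integrable fun v : ℝ => H (((-(1 / 2) : ℝ) : ℂ) + v * Complex.I) := by
    simp only [hHl]; exact (i2.sub (i3.const_mul _)).neg
  have hlim1 := ((MeasureTheory.intervalIntegral_tendsto_integral hir Filter.tendsto_neg_atTop_atBot
    Filter.tendsto_id).sub (MeasureTheory.intervalIntegral_tendsto_integral hil
      Filter.tendsto_neg_atTop_atBot Filter.tendsto_id)).const_mul Complex.I
  have heq := tendsto_nhds_unique (hlim1.congr hrect) hlim0
  simp only [hHr, hHl] at heq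
  rw [MeasureTheory.integral_neg, MeasureTheory.integral_sub i1 (i3.const_mul _),
    MeasureTheory.integral_sub i2 (i3.const_mul _), MeasureTheory.integral_const_mul] at heq
  have hc : (∫ v : ℝ, 1 / (Real.cosh (Real.pi * v) : ℂ))
      = ((∫ v : ℝ, 1 / Real.cosh (Real.pi * v) : ℝ) : ℂ) := by
    rw [← integral_complex_ofReal]; simp
  rw [hc] at heq
  have := (mul_eq_zero.mp heq).resolve_left Complex.I_ne_zero
  linear_combination this

/-- An alternating sum of values of a function analytic and of exponential type less than `π`
on the strip `|re z| ≤ N + 1/2` telescopes into two integrals over the edges of the strip. -/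
theorem alternating_sum_eq_integral_edges {f : ℂ → ℂ} {U : Set ℂ} {θ M : ℝ} (N : ℕ) (hU : IsOpen U)
    (hUs : ∀ z : ℂ, |z.re| ≤ N + 1 / 2 → z ∈ U) (hf : DifferentiableOn ℂ f U)
    (hθ0 : 0 ≤ θ) (hθ : θ < Real.pi) (hM : 0 ≤ M)
    (hb : ∀ z : ℂ, |z.re| ≤ N + 1 / 2 → ‖f z‖ ≤ M * Real.exp (θ * |z.im|)) :
    2 * ((∫ v : ℝ, 1 / Real.cosh (Real.pi * v) : ℝ) : ℂ) *
      (∑ l ∈ Finset.Icc (-(N : ℤ)) N, (-1 : ℂ) ^ l * f l)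
      = (-1) ^ N * ((∫ v : ℝ, f ((N + 1 / 2 : ℝ) + v * Complex.I) / (Real.cosh (Real.pi * v) : ℂ)) +
        ∫ v : ℝ, f ((-(N + 1 / 2) : ℝ) + v * Complex.I) / (Real.cosh (Real.pi * v) : ℂ)) := by
  -- With I(c) the weighted integral over re z = c, this reads I(n + 1/2) + I(n - 1/2) = 2 (∫
  -- 1/cosh) f(n). Under alternating signs all inner I(c) cancel.
  have step : ∀ n : ℤ, |n| ≤ N →
      (∫ v : ℝ, f ((n + 1 / 2 : ℝ) + v * Complex.I) / (Real.cosh (Real.pi * v) : ℂ)) +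
        (∫ v : ℝ, f ((n - 1 / 2 : ℝ) + v * Complex.I) / (Real.cosh (Real.pi * v) : ℂ))
      = 2 * ((∫ v : ℝ, 1 / Real.cosh (Real.pi * v) : ℝ) : ℂ) * f n := by
    intro n hn
    have hn' : |(n : ℝ)| ≤ N := by exact_mod_cast hn
    have hmem : ∀ z : ℂ, |z.re| ≤ 1 / 2 → |((n : ℂ) + z).re| ≤ N + 1 / 2 := by
      intro z hz
      rw [Complex.add_re, Complex.intCast_re]
      exact (abs_add_le _ _).trans (add_le_add hn' hz)
    have := integral_edges_div_cosh (f := fun z => f (n + z)) (U := (fun z : ℂ => (n : ℂ) + z) ⁻¹' U)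
      (hU.preimage (by fun_prop)) (fun z hz => hUs _ (hmem z hz))
      (hf.comp (by fun_prop) (Set.mapsTo_preimage _ _)) hθ0 hθ hM
      (fun z hz => by simpa using hb _ (hmem z hz))
    rw [add_zero] at this
    rw [← this]
    congr 2 <;> · ext v; congr 2; push_cast; ring
  suffices h : ∀ m : ℕ, m ≤ N → 2 * ((∫ v : ℝ, 1 / Real.cosh (Real.pi * v) : ℝ) : ℂ) *
      (∑ l ∈ Finset.Icc (-(m : ℤ)) m, (-1 : ℂ) ^ l * f l)
      = (-1) ^ m * ((∫ v : ℝ, f ((m + 1 / 2 : ℝ) + v * Complex.I) / (Real.cosh (Real.pi * v) : ℂ)) +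
        ∫ v : ℝ, f ((-(m + 1 / 2) : ℝ) + v * Complex.I) / (Real.cosh (Real.pi * v) : ℂ)) from
    h N le_rfl
  intro m
  induction m with
  | zero =>
    intro _
    have := step 0 (by simp)
    simp at this ⊢
    rw [← this]
  | succ m ih =>
    intro hm
    have h1 := ih (by omega)
    have h2 := step (m + 1 : ℕ) (by rw [abs_of_nonneg (by positivity)]; exact_mod_cast hm)
    have h3 := step (-(m + 1 : ℕ)) (by rw [abs_neg, abs_of_nonneg (by positivity)]; exact_mod_cast hm)
    have hset : Finset.Icc (-((m + 1 : ℕ) : ℤ)) ((m + 1 : ℕ) : ℤ)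
        = insert (((m + 1 : ℕ) : ℤ)) (insert (-((m + 1 : ℕ) : ℤ)) (Finset.Icc (-(m : ℤ)) m)) := by
      ext l; simp only [Finset.mem_insert, Finset.mem_Icc]; push_cast; omega
    rw [hset, Finset.sum_insert (by simp; omega), Finset.sum_insert (by simp), zpow_neg,
      zpow_natCast, mul_add, mul_add, h1]
    have hinv : ((-1 : ℂ) ^ (m + 1))⁻¹ = (-1) ^ (m + 1) := by
      rw [← inv_pow]; norm_num
    rw [hinv]
    have e1 : (((m + 1 : ℕ) : ℤ) - 1 / 2 : ℝ) = m + 1 / 2 := by push_cast; ring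
    have e2 : (((-((m + 1 : ℕ) : ℤ)) : ℤ) + 1 / 2 : ℝ) = -(m + 1 / 2) := by push_cast; ring
    have e3 : (((-((m + 1 : ℕ) : ℤ)) : ℤ) - 1 / 2 : ℝ) = -((m + 1 : ℕ) + 1 / 2) := by push_cast; ring
    have e4 : (((m + 1 : ℕ) : ℤ) + 1 / 2 : ℝ) = (m + 1 : ℕ) + 1 / 2 := by push_cast; ring
    rw [e1, e4] at h2
    rw [e2, e3] at h3
    rw [pow_succ] at *
    linear_combination (-1 : ℂ) ^ m * h2 + (-1 : ℂ) ^ m * h3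

/-- The bound M inside the strip only justifies the contour argument and is absent from the
estimate. Only the size M' on the two outer edges counts, which is the source of the saving. -/
theorem exists_norm_alternating_sum_le {θ : ℝ} (hθ0 : 0 ≤ θ) (hθ : θ < Real.pi) :
    ∃ C : ℝ, 0 < C ∧ ∀ (f : ℂ → ℂ) (U : Set ℂ) (M M' : ℝ) (N : ℕ), IsOpen U →
      (∀ z : ℂ, |z.re| ≤ N + 1 / 2 → z ∈ U) → DifferentiableOn ℂ f U → 0 ≤ M → 0 ≤ M' →
      (∀ z : ℂ, |z.re| ≤ N + 1 / 2 → ‖f z‖ ≤ M * Real.exp (θ * |z.im|)) →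
      (∀ z : ℂ, |z.re| = N + 1 / 2 → ‖f z‖ ≤ M' * Real.exp (θ * |z.im|)) →
      ‖∑ l ∈ Finset.Icc (-(N : ℤ)) N, (-1 : ℂ) ^ l * f l‖ ≤ C * M' := by
  have hc := integral_inv_cosh_pos
  set c := ∫ v : ℝ, 1 / Real.cosh (Real.pi * v) with hcdef
  set J := ∫ v : ℝ, 2 * Real.exp (-((Real.pi - θ) * |v|)) with hJ
  have hJ0 : 0 ≤ J := MeasureTheory.integral_nonneg fun v => by positivity
  refine ⟨J / c + 1, by positivity, ?_⟩
  intro f U M M' N hU hUs hf hM hM' hb hb'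
  have h1 := alternating_sum_eq_integral_edges N hU hUs hf hθ0 hθ hM hb
  have hN : (0 : ℝ) ≤ N + 1 / 2 := by positivity
  have h2 := norm_integral_div_cosh_le (g := fun v : ℝ => f ((N + 1 / 2 : ℝ) + v * Complex.I)) hθ hM'
    (fun v => by simpa using hb' ((N + 1 / 2 : ℝ) + v * Complex.I) (by
      rw [Complex.add_re, Complex.ofReal_re, Complex.re_ofReal_mul]
      simp only [Complex.I_re, mul_zero, add_zero]
      exact abs_of_nonneg hN))
  have h3 := norm_integral_div_cosh_le (g := fun v : ℝ => f ((-(N + 1 / 2) : ℝ) + v * Complex.I)) hθ hM'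
    (fun v => by simpa using hb' ((-(N + 1 / 2) : ℝ) + v * Complex.I) (by
      rw [Complex.add_re, Complex.ofReal_re, Complex.re_ofReal_mul]
      simp only [Complex.I_re, mul_zero, add_zero]
      rw [abs_neg]
      exact abs_of_nonneg hN))
  have h4 := congrArg norm h1
  rw [norm_mul, norm_mul, norm_mul, norm_pow, norm_neg, norm_one, one_pow, one_mul, Complex.norm_real,
    Real.norm_of_nonneg hc.le, Complex.norm_ofNat] at h4
  have h5 : 2 * c * ‖∑ l ∈ Finset.Icc (-(N : ℤ)) N, (-1 : ℂ) ^ l * f l‖ ≤ 2 * (M' * J) := by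
    rw [h4]
    refine (norm_add_le _ _).trans ?_
    linarith
  calc _ ≤ J / c * M' := by
        rw [div_mul_eq_mul_div, le_div_iff₀ hc]; linarith
    _ ≤ _ := by gcongr; linarith

/-! ### The complex semicircle and the central part -/

/-- The principal square root of `x - z ^ 2 / T`. -/
noncomputable def semicircleSqrt (x T : ℝ) (z : ℂ) : ℂ := ((x : ℂ) - z ^ 2 / T) ^ (2⁻¹ : ℂ)

theorem semicircleSqrt_sq (x T : ℝ) (z : ℂ) : semicircleSqrt x T z ^ 2 = (x : ℂ) - z ^ 2 / T := by
  exact Complex.cpow_nat_inv_pow _ two_ne_zero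

theorem re_sub_sq_div (x T : ℝ) (z : ℂ) :
    ((x : ℂ) - z ^ 2 / T).re = x - z.re ^ 2 / T + z.im ^ 2 / T := by
  rw [Complex.sub_re, Complex.ofReal_re, Complex.div_ofReal_re, sq z, Complex.mul_re]
  ring

theorem im_sub_sq_div (x T : ℝ) (z : ℂ) :
    ((x : ℂ) - z ^ 2 / T).im = -(2 * z.re * z.im / T) := by
  rw [Complex.sub_im, Complex.ofReal_im, Complex.div_ofReal_im, sq z, Complex.mul_im]
  ring

theorem semicircleSqrt_ofReal {x T : ℝ} {u : ℝ} (h : 0 ≤ x - u ^ 2 / T) :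
    semicircleSqrt x T u = (√(x - u ^ 2 / T) : ℂ) := by
  rw [semicircleSqrt, Real.sqrt_eq_rpow, Complex.ofReal_cpow h]
  push_cast
  norm_num

theorem differentiableOn_semicircleSqrt (x T : ℝ) :
    DifferentiableOn ℂ (semicircleSqrt x T) {z | 0 < ((x : ℂ) - z ^ 2 / T).re} := by
  intro z hz
  refine (DifferentiableAt.cpow (by fun_prop) (by fun_prop) ?_).differentiableWithinAt
  exact Or.inl hz

/-- Growth of `exp (s √(x - z ^ 2 / T))` in vertical direction: the exponent grows at most like
`θ |im z|`, where `κ` bounds the slope of the semicircle at `re z`. -/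
theorem norm_exp_mul_semicircleSqrt_le {x T α β κ θ : ℝ} {z : ℂ} (hT : 0 < T)
    (hφ : 0 < x - z.re ^ 2 / T) (hα : 0 ≤ α) (hβ : |β| ≤ √T)
    (hκ : |z.re| ≤ κ * √T * √(x - z.re ^ 2 / T)) (hθ : α * (1 + κ) / √T + κ ≤ θ) :
    ‖Complex.exp (((α : ℂ) + (β : ℂ) * Complex.I) * semicircleSqrt x T z)‖
      ≤ Real.exp (α * √(x - z.re ^ 2 / T)) * Real.exp (θ * |z.im|) := by
  have hsT : 0 < √T := Real.sqrt_pos.mpr hT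
  have eT : √T ^ 2 = T := Real.sq_sqrt hT.le
  set u := z.re with hu
  set v := z.im with hv
  set φ := √(x - u ^ 2 / T) with hφd
  have hφ0 : 0 < φ := Real.sqrt_pos.mpr hφ
  have eφ : φ ^ 2 = x - u ^ 2 / T := Real.sq_sqrt hφ.le
  set p := (semicircleSqrt x T z).re with hp
  set q := (semicircleSqrt x T z).im with hq
  have hp0 : 0 ≤ p := by
    rw [hp, semicircleSqrt, Complex.cpow_inv_two_re]; positivity
  have hsq := semicircleSqrt_sq x T z
  have hre := congrArg Complex.re hsq
  have him := congrArg Complex.im hsq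
  rw [re_sub_sq_div, sq, Complex.mul_re, ← hp, ← hq, ← hu, ← hv] at hre
  rw [im_sub_sq_div, sq, Complex.mul_im, ← hp, ← hq, ← hu, ← hv] at him
  have hp2 : p ^ 2 = φ ^ 2 + (|v| / √T) ^ 2 + |q| ^ 2 := by
    rw [div_pow, sq_abs, sq_abs, eT, eφ]; linarith
  have hφp : φ ≤ p := by
    apply le_of_sq_le_sq _ hp0
    nlinarith [sq_nonneg (|v| / √T), sq_nonneg |q|]
  have hpq : p * |q| = |u| * |v| / T := by
    have : p * q = -(u * v / T) := by linear_combination him / 2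
    rw [← abs_of_nonneg hp0, ← abs_mul, this, abs_neg, abs_div, abs_mul, abs_of_pos hT]
  -- With the root written p + iq, the relations p |q| = |u||v|/T and p ≥ φ bound q by the slope of
  -- the semicircle. The factor |β| ≤ √T then turns |βq| into at most κ|v|.
  have hq' : |q| ≤ κ * (|v| / √T) := by
    have h1 : φ * |q| ≤ φ * (κ * (|v| / √T)) := by
      calc φ * |q| ≤ p * |q| := by gcongr
        _ = |u| * |v| / T := hpq
        _ ≤ (κ * √T * φ) * |v| / T := by gcongr
        _ = φ * (κ * (√T * |v| / √T ^ 2)) := by rw [eT]; ring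
        _ = φ * (κ * (|v| / √T)) := by congr 2; field_simp
    exact le_of_mul_le_mul_left h1 hφ0
  have hp' : p ≤ φ + |v| / √T + |q| := by
    have : 0 ≤ |v| / √T := by positivity
    apply le_of_sq_le_sq _ (by positivity)
    nlinarith [abs_nonneg q, mul_nonneg hφ0.le this, mul_nonneg hφ0.le (abs_nonneg q),
      mul_nonneg this (abs_nonneg q)]
  rw [Complex.norm_exp, ← Real.exp_add]
  apply Real.exp_le_exp.mpr
  have e : (((α : ℂ) + (β : ℂ) * Complex.I) * semicircleSqrt x T z).re = α * p - β * q := by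
    simp [Complex.mul_re, hp, hq]
  rw [e]
  have h1 : -(β * q) ≤ √T * (κ * (|v| / √T)) := by
    calc -(β * q) ≤ |β * q| := neg_le_abs _
      _ = |β| * |q| := abs_mul _ _
      _ ≤ _ := by gcongr
  have h2 : √T * (κ * (|v| / √T)) = κ * |v| := by field_simp
  have h3 : α * p ≤ α * (φ + |v| / √T + κ * (|v| / √T)) := by gcongr; linarith
  have h4 : α * (φ + |v| / √T + κ * (|v| / √T)) = α * φ + α * (1 + κ) / √T * |v| := by
    field_simp; ring
  have h5 := mul_le_mul_of_nonneg_right hθ (abs_nonneg v)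
  linarith

/-- The central part of the oscillating sum is controlled by its boundary terms. -/
theorem exists_norm_central_sum_le {κ θ : ℝ} (hθ0 : 0 ≤ θ) (hθ : θ < Real.pi) :
    ∃ C : ℝ, 0 < C ∧ ∀ (x T α β : ℝ) (N : ℕ), 0 < T → 0 ≤ α → |β| ≤ √T →
      0 < x - ((N : ℝ) + 1 / 2) ^ 2 / T →
      (N : ℝ) + 1 / 2 ≤ κ * √T * √(x - ((N : ℝ) + 1 / 2) ^ 2 / T) → 0 ≤ κ →
      α * (1 + κ) / √T + κ ≤ θ →
      ‖∑ l ∈ Finset.Icc (-(N : ℤ)) N, (-1 : ℂ) ^ l *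
          Complex.exp (((α : ℂ) + (β : ℂ) * Complex.I) * (√(x - (l : ℝ) ^ 2 / T) : ℂ))‖
        ≤ C * Real.exp (α * √(x - ((N : ℝ) + 1 / 2) ^ 2 / T)) := by
  obtain ⟨C, hC, h⟩ := exists_norm_alternating_sum_le hθ0 hθ
  refine ⟨C, hC, ?_⟩
  intro x T α β N hT hα hβ hφ hκN hκ0 hκθ
  -- The slope is largest on the outer edges, so the hypothesis at N + 1/2 controls the whole strip.
  have hmono : ∀ u : ℝ, |u| ≤ N + 1 / 2 → x - ((N : ℝ) + 1 / 2) ^ 2 / T ≤ x - u ^ 2 / T := by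
    intro u hu
    have : u ^ 2 ≤ ((N : ℝ) + 1 / 2) ^ 2 := by rw [← sq_abs]; gcongr
    gcongr
  have hx : ∀ u : ℝ, x - u ^ 2 / T ≤ x := by
    intro u
    have : 0 ≤ u ^ 2 / T := by positivity
    linarith
  have key : ∀ z : ℂ, |z.re| ≤ N + 1 / 2 →
      ‖Complex.exp (((α : ℂ) + (β : ℂ) * Complex.I) * semicircleSqrt x T z)‖
      ≤ Real.exp (α * √(x - z.re ^ 2 / T)) * Real.exp (θ * |z.im|) := by
    intro z hz
    refine norm_exp_mul_semicircleSqrt_le hT (hφ.trans_le (hmono _ hz)) hα hβ ?_ hκθ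
    calc |z.re| ≤ _ := hz
      _ ≤ _ := hκN
      _ ≤ _ := by gcongr κ * √T * √?_; exact hmono _ hz
  have hS := h (fun z => Complex.exp (((α : ℂ) + (β : ℂ) * Complex.I) * semicircleSqrt x T z))
    {z | 0 < ((x : ℂ) - z ^ 2 / T).re} (Real.exp (α * √x))
    (Real.exp (α * √(x - ((N : ℝ) + 1 / 2) ^ 2 / T))) N ?_ ?_ ?_ (by positivity) (by positivity) ?_ ?_
  · refine le_trans (le_of_eq ?_) hS
    congr 1
    refine Finset.sum_congr rfl fun l hl => ?_
    rw [Finset.mem_Icc] at hl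
    have h1 : |(l : ℝ)| ≤ N + 1 / 2 := by
      have : |l| ≤ N := abs_le.mpr hl
      have : |(l : ℝ)| ≤ N := by exact_mod_cast this
      linarith
    have h2 := semicircleSqrt_ofReal (u := (l : ℝ)) (hφ.le.trans (hmono _ h1))
    rw [Complex.ofReal_intCast] at h2
    simp only [h2]
  · exact isOpen_lt continuous_const (Complex.continuous_re.comp (by fun_prop))
  · intro z hz
    rw [Set.mem_ofPred_eq, re_sub_sq_div]
    have h1 := hmono _ hz
    have : 0 ≤ z.im ^ 2 / T := by positivity
    linarith
  · exact ((differentiableOn_semicircleSqrt x T).const_mul _).cexp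
  · intro z hz
    refine (key z hz).trans ?_
    gcongr
    exact hx _
  · intro z hz
    refine (key z hz.le).trans_eq ?_
    rw [← sq_abs z.re, hz]

/-! ### The outer part -/

/-- Meant for three consecutive values p, q, r of the semicircle, with A = 2l + 1. Dividing
differences of squares by sums gives a second difference of at least (A/T)(p - r) / ((q + r)(p +
q)), while p - r ≥ A/(Tp). The extra 2/T only helps. -/
theorem second_difference_ge {p q r A T : ℝ} (hT : 0 < T) (hA : 0 ≤ A) (hr : 0 < r) (hrq : r ≤ q)
    (hqp : q ≤ p) (h1 : p ^ 2 - q ^ 2 = A / T) (h2 : q ^ 2 - r ^ 2 = (A + 2) / T) :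
    A ^ 2 / (4 * T ^ 2 * p ^ 3) ≤ (q - r) - (p - q) := by
  have hq : 0 < q := hr.trans_le hrq
  have hp : 0 < p := hq.trans_le hqp
  have e1 : p - q = A / T / (p + q) := by rw [← h1]; field_simp; ring
  have e2 : A / T / (q + r) ≤ q - r := by
    rw [div_le_iff₀ (by positivity)]
    have : (q - r) * (q + r) = (A + 2) / T := by rw [← h2]; ring
    rw [this]; gcongr; linarith
  have e3 : A / (T * p) ≤ p - r := by
    have h3 : (p - r) * (p + r) = 2 * (A / T) + 2 / T := by
      have : (A + 2) / T = A / T + 2 / T := by ring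
      rw [this] at h2
      linear_combination h1 + h2
    have h4 : 0 ≤ 2 / T := by positivity
    have h5 : 2 * (A / T) ≤ (p - r) * (2 * p) := by
      have : (p - r) * (p + r) ≤ (p - r) * (2 * p) := by
        apply mul_le_mul_of_nonneg_left <;> linarith
      linarith
    rw [← div_div, div_le_iff₀ hp]
    linarith
  have e4 : A / T / (q + r) - A / T / (p + q) = A / T * (p - r) / ((q + r) * (p + q)) := by
    field_simp; ring
  calc A ^ 2 / (4 * T ^ 2 * p ^ 3) = A / T * (A / (T * p)) / ((2 * p) * (2 * p)) := by
        field_simp; ring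
    _ ≤ A / T * (p - r) / ((q + r) * (p + q)) := by
        gcongr
        · exact mul_nonneg (by positivity) (by linarith)
        · linarith
        · linarith
    _ ≤ _ := by rw [← e4, e1]; linarith

theorem sq_sqrt_sub_sq_div {x T u : ℝ} (hT : 0 < T) (hu : u ^ 2 < T * x) :
    0 < √(x - u ^ 2 / T) ∧ √(x - u ^ 2 / T) ^ 2 = x - u ^ 2 / T := by
  have h : 0 < x - u ^ 2 / T := by
    rw [sub_pos, div_lt_iff₀ hT]; linarith
  exact ⟨Real.sqrt_pos.mpr h, Real.sq_sqrt h.le⟩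

theorem sqrt_sub_sq_div_anti {x T u v : ℝ} (hT : 0 < T) (hu : 0 ≤ u) (huv : u ≤ v) :
    √(x - v ^ 2 / T) ≤ √(x - u ^ 2 / T) := by
  gcongr

theorem exists_norm_outer_sum_le_of_nonneg :
    ∃ C : ℝ, 0 < C ∧ ∀ (x T β : ℝ) (a b : ℕ), 0 < T → 0 < x → 1 ≤ T * x → 0 ≤ β → β ≤ √T →
      1 ≤ a → a ≤ b → (b : ℝ) ^ 2 < T * x → T * x / 4 ≤ (a : ℝ) ^ 2 →
      ‖∑ l ∈ Finset.Ico a b, (-1 : ℂ) ^ l *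
        Complex.exp (((-(β * √(x - (l : ℝ) ^ 2 / T)) : ℝ) : ℂ) * Complex.I)‖ ≤ C * √(√(T * x)) := by
  obtain ⟨C, hC, h⟩ := exists_norm_sum_le_sqrt_of_cubic_growth (c₁ := 1 / 108) (c₂ := 9)
    -- The constants come from D φ ≤ 3β√x/√T. Cubing, with β² ≤ T, and comparing with the second
    -- difference βx/(4Tφ³) gives 1/108 = 1/(4 · 27). Squaring, with L - l ≤ Tφ²/L, gives 9.
    (by norm_num) (by norm_num)
  refine ⟨C, hC, ?_⟩
  intro x T β a b hT hx hTx hβ0 hβ ha hab hb ha4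
  have hsT : 0 < √T := Real.sqrt_pos.mpr hT
  have eT : √T ^ 2 = T := Real.sq_sqrt hT.le
  have hsx : 0 < √x := Real.sqrt_pos.mpr hx
  have ex : √x ^ 2 = x := Real.sq_sqrt hx.le
  have eL : √(T * x) = √T * √x := Real.sqrt_mul hT.le x
  have hβ2 : β ^ 2 ≤ T := by rw [← eT]; gcongr
  set φ : ℕ → ℝ := fun l => √(x - (l : ℝ) ^ 2 / T) with hφ
  have hφp : ∀ l, l ≤ b → 0 < φ l ∧ φ l ^ 2 = x - (l : ℝ) ^ 2 / T := by
    intro l hl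
    refine sq_sqrt_sub_sq_div hT (lt_of_le_of_lt ?_ hb)
    gcongr
  have hanti : ∀ l, φ (l + 1) ≤ φ l := fun l =>
    sqrt_sub_sq_div_anti hT (by positivity) (by push_cast; linarith)
  have hdiff : ∀ l, l + 1 ≤ b → φ l ^ 2 - φ (l + 1) ^ 2 = (2 * (l : ℝ) + 1) / T := by
    intro l hl
    rw [(hφp l (by omega)).2, (hφp (l + 1) hl).2]; push_cast; ring
  have hlL : ∀ l, l ≤ b → (l : ℝ) ≤ √T * √x := by
    intro l hl
    rw [← eL]
    apply Real.le_sqrt_of_sq_le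
    refine le_trans ?_ hb.le
    gcongr
  have hDp : ∀ l, a ≤ l → l < b → β * (φ l - φ (l + 1)) * φ l ≤ 3 * β * √x / √T := by
    intro l h1 h2
    have h3 := hdiff l h2
    have h4 := (hφp l h2.le).1
    have h5 := (hφp (l + 1) h2).1
    have h6 := hanti l
    have h7 : (φ l - φ (l + 1)) * φ l ≤ (2 * (l : ℝ) + 1) / T := by
      rw [← h3]; nlinarith
    have h8 : (1 : ℝ) ≤ l := by exact_mod_cast ha.trans h1
    calc β * (φ l - φ (l + 1)) * φ l = β * ((φ l - φ (l + 1)) * φ l) := by ring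
      _ ≤ β * ((2 * (l : ℝ) + 1) / T) := by gcongr
      _ ≤ β * ((3 * (√T * √x)) / T) := by
          gcongr
          linarith [hlL l h2.le]
      _ = _ := by nth_rewrite 2 [← eT]; field_simp
  refine h (√(T * x)) a b _ (fun l => β * (φ l - φ (l + 1))) (Real.one_le_sqrt.mpr hTx) hab
    ?_ ?_ ?_ ?_ ?_
  · intro l
    rw [norm_mul, norm_pow, norm_neg, norm_one, one_pow, Complex.norm_exp_ofReal_mul_I, one_mul]
  · intro l _ _
    rw [mul_left_comm, ← Complex.exp_add, pow_succ]
    have : ((β * (φ l - φ (l + 1)) : ℝ) : ℂ) * Complex.I + ((-(β * √(x - (l : ℝ) ^ 2 / T)) : ℝ) : ℂ) * Complex.I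
        = ((-(β * √(x - ((l + 1 : ℕ) : ℝ) ^ 2 / T)) : ℝ) : ℂ) * Complex.I := by
      simp only [hφ]; push_cast; ring
    rw [this]; ring
  · intro l _ _
    exact mul_nonneg hβ0 (sub_nonneg.mpr (hanti l))
  · intro l h1 h2
    have hp := (hφp l (by omega)).1
    have hr := (hφp (l + 2) (by omega)).1
    have hsd := second_difference_ge (A := 2 * (l : ℝ) + 1) hT (by positivity) hr (hanti (l + 1)) (hanti l)
      (hdiff l (by omega)) (by rw [hdiff (l + 1) (by omega)]; push_cast; ring)
    have hlow : x / (4 * T * φ l ^ 3) ≤ (φ (l + 1) - φ (l + 2)) - (φ l - φ (l + 1)) := by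
      refine le_trans ?_ hsd
      have h5 : T * x ≤ (2 * (l : ℝ) + 1) ^ 2 := by
        have : (a : ℝ) ≤ l := by exact_mod_cast h1
        have : (a : ℝ) ^ 2 ≤ (l : ℝ) ^ 2 := by gcongr
        nlinarith [(l.cast_nonneg : (0 : ℝ) ≤ l)]
      calc x / (4 * T * φ l ^ 3) = T * x / (4 * T ^ 2 * φ l ^ 3) := by field_simp
        _ ≤ _ := by gcongr
    have hD3 := pow_le_pow_left₀
      (mul_nonneg (mul_nonneg hβ0 (sub_nonneg.mpr (hanti l))) hp.le) (hDp l h1 (by omega)) 3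
    have hD3' : (β * (φ l - φ (l + 1))) ^ 3 ≤ 27 * β * x * √x / √T / φ l ^ 3 := by
      rw [le_div_iff₀ (by positivity), ← mul_pow]
      refine hD3.trans ?_
      calc (3 * β * √x / √T) ^ 3 = 27 * β * β ^ 2 * √x ^ 2 * √x / (√T ^ 2 * √T) := by
            field_simp; ring
        _ ≤ 27 * β * T * √x ^ 2 * √x / (√T ^ 2 * √T) := by gcongr
        _ = _ := by rw [ex, eT]; field_simp
    calc 1 / 108 * (β * (φ l - φ (l + 1))) ^ 3 / √(T * x)
        ≤ 1 / 108 * (27 * β * x * √x / √T / φ l ^ 3) / √(T * x) := by gcongr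
      _ = β * (x / (4 * √T ^ 2 * φ l ^ 3)) := by rw [eL]; field_simp; ring
      _ = β * (x / (4 * T * φ l ^ 3)) := by rw [eT]
      _ ≤ β * ((φ (l + 1) - φ (l + 2)) - (φ l - φ (l + 1))) := by gcongr
      _ = _ := by ring
  · intro l h1 h2
    have hp := hφp l h2.le
    have hL0 : 0 < √(T * x) := by rw [eL]; positivity
    have hLL : √(T * x) ^ 2 = T * x := Real.sq_sqrt (by positivity)
    have hbL := hlL b le_rfl
    have hl := hlL l h2.le
    rw [← eL] at hbL hl
    have hl0 : (0 : ℝ) ≤ l := by positivity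
    have h3 : (√(T * x) - l) * √(T * x) ≤ T * φ l ^ 2 := by
      rw [hp.2]
      have : T * (x - (l : ℝ) ^ 2 / T) = (√(T * x) - l) * (√(T * x) + l) := by
        rw [mul_sub, mul_div_cancel₀ _ hT.ne']; linear_combination -hLL
      rw [this]
      apply mul_le_mul_of_nonneg_left <;> linarith
    have h4 : (β * (φ l - φ (l + 1))) ^ 2 * φ l ^ 2 ≤ 9 * x := by
      rw [← mul_pow]
      calc _ ≤ (3 * β * √x / √T) ^ 2 := pow_le_pow_left₀
            (mul_nonneg (mul_nonneg hβ0 (sub_nonneg.mpr (hanti l))) hp.1.le) (hDp l h1 h2) 2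
        _ = 9 * β ^ 2 * x / T := by rw [div_pow, mul_pow, mul_pow, ex, eT]; norm_num
        _ ≤ 9 * T * x / T := by gcongr
        _ = _ := by field_simp
    set Q := (β * (φ l - φ (l + 1))) ^ 2 with hQ
    have hQ0 : 0 ≤ Q := sq_nonneg _
    have h5 : ((b : ℝ) - l) * Q * √(T * x) ≤ 9 * √(T * x) * √(T * x) := by
      calc ((b : ℝ) - l) * Q * √(T * x) ≤ (√(T * x) - l) * Q * √(T * x) := by gcongr
        _ = Q * ((√(T * x) - l) * √(T * x)) := by ring
        _ ≤ Q * (T * φ l ^ 2) := by gcongr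
        _ = T * (Q * φ l ^ 2) := by ring
        _ ≤ T * (9 * x) := by gcongr
        _ = _ := by linear_combination -9 * hLL
    exact le_of_mul_le_mul_right h5 hL0

/-- The pure oscillation over `T x / 4 ≤ l ^ 2 < T x` is at most of order `(T x) ^ (1 / 4)`. -/
theorem exists_norm_outer_sum_le :
    ∃ C : ℝ, 0 < C ∧ ∀ (x T β : ℝ) (a b : ℕ), 0 < T → 0 < x → 1 ≤ T * x → |β| ≤ √T →
      1 ≤ a → a ≤ b → (b : ℝ) ^ 2 < T * x → T * x / 4 ≤ (a : ℝ) ^ 2 →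
      ‖∑ l ∈ Finset.Ico a b, (-1 : ℂ) ^ l *
        Complex.exp (((β * √(x - (l : ℝ) ^ 2 / T) : ℝ) : ℂ) * Complex.I)‖ ≤ C * √(√(T * x)) := by
  obtain ⟨C, hC, h⟩ := exists_norm_outer_sum_le_of_nonneg
  refine ⟨C, hC, ?_⟩
  intro x T β a b hT hx hTx hβ ha hab hb ha4
  have h1 := h x T |β| a b hT hx hTx (abs_nonneg β) hβ ha hab hb ha4
  -- The increments were arranged to be nonnegative for the phase -|β|φ; positive β follows by
  -- conjugation.
  rcases le_total β 0 with h0 | h0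
  · simpa only [abs_of_nonpos h0, neg_mul, neg_neg] using h1
  · rw [abs_of_nonneg h0] at h1
    rw [← Complex.norm_conj, map_sum]
    convert h1 using 4 with l _
    rw [map_mul, map_pow, map_neg, map_one, ← Complex.exp_conj, map_mul, Complex.conj_ofReal,
      Complex.conj_I]
    congr 2
    push_cast; ring

/-! ### Cutting and reassembling the sum -/

/-- Because the inequality is strict, the largest l is ⌈√y⌉₊ - 1, also when √y is an integer. -/
theorem integersWithSqLT_eq_Icc {y : ℝ} (hy : 0 < y) :
    integersWithSqLT y = Finset.Icc (-((⌈√y⌉₊ - 1 : ℕ) : ℤ)) ((⌈√y⌉₊ - 1 : ℕ) : ℤ) := by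
  have h0 : 0 < ⌈√y⌉₊ := Nat.ceil_pos.mpr (Real.sqrt_pos.mpr hy)
  ext l
  rw [mem_integersWithSqLT, Finset.mem_Icc, ← abs_le, ← sq_abs, ← Real.lt_sqrt (abs_nonneg _),
    ← Int.cast_abs, Int.abs_eq_natAbs, Int.cast_natCast, ← Nat.lt_ceil]
  omega

theorem sum_Icc_neg_eq_of_even {F : ℤ → ℂ} (hF : ∀ l, F (-l) = F l) {N M : ℕ} (hNM : N ≤ M) :
    ∑ l ∈ Finset.Icc (-(M : ℤ)) M, F l
      = ∑ l ∈ Finset.Icc (-(N : ℤ)) N, F l + 2 * ∑ l ∈ Finset.Ico (N + 1) (M + 1), F (l : ℤ) := by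
  induction M, hNM using Nat.le_induction with
  | base => simp
  | succ m hm ih =>
    have hset : Finset.Icc (-((m + 1 : ℕ) : ℤ)) ((m + 1 : ℕ) : ℤ)
        = insert (((m + 1 : ℕ) : ℤ)) (insert (-((m + 1 : ℕ) : ℤ)) (Finset.Icc (-(m : ℤ)) m)) := by
      ext l; simp only [Finset.mem_insert, Finset.mem_Icc]; push_cast; omega
    rw [hset, Finset.sum_insert (by simp; omega), Finset.sum_insert (by simp), hF, ih,
      Finset.sum_Ico_succ_top (by omega : N + 1 ≤ m + 1)]
    ring

/-- The terms of the oscillating sum beyond `N` are controlled by the largest amplitude. -/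
theorem exists_norm_weighted_outer_sum_le :
    ∃ C : ℝ, 0 < C ∧ ∀ (x T α β : ℝ) (N M : ℕ), 0 < T → 0 < x → 1 ≤ T * x → 0 ≤ α → |β| ≤ √T →
      (M : ℝ) ^ 2 < T * x → T * x / 4 ≤ ((N : ℝ) + 1) ^ 2 →
      ‖∑ l ∈ Finset.Ico (N + 1) (M + 1), (-1 : ℂ) ^ l *
          Complex.exp (((α : ℂ) + (β : ℂ) * Complex.I) * (√(x - (l : ℝ) ^ 2 / T) : ℂ))‖
        ≤ C * (Real.exp (α * √(x - ((N : ℝ) + 1) ^ 2 / T)) * √(√(T * x))) := by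
  obtain ⟨C, hC, h⟩ := exists_norm_outer_sum_le
  refine ⟨C + 1, by positivity, ?_⟩
  intro x T α β N M hT hx hTx hα hβ hM hN
  have hs1 : 1 ≤ √(√(T * x)) := Real.one_le_sqrt.mpr (Real.one_le_sqrt.mpr hTx)
  rcases Nat.lt_or_ge N M with hNM | hNM
  swap
  · rw [Finset.Ico_eq_empty_of_le (by omega)]; simp; positivity
  have hsplit : ∀ l : ℕ, (-1 : ℂ) ^ l *
      Complex.exp (((α : ℂ) + (β : ℂ) * Complex.I) * (√(x - (l : ℝ) ^ 2 / T) : ℂ))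
      = ((Real.exp (α * √(x - (l : ℝ) ^ 2 / T)) : ℝ) : ℂ) *
        ((-1 : ℂ) ^ l * Complex.exp (((β * √(x - (l : ℝ) ^ 2 / T) : ℝ) : ℂ) * Complex.I)) := by
    intro l
    rw [Complex.ofReal_exp, mul_left_comm, ← Complex.exp_add]
    congr 2; push_cast; ring
  simp only [hsplit]
  refine (norm_sum_mul_le_of_antitone (A := fun l : ℕ => Real.exp (α * √(x - (l : ℝ) ^ 2 / T)))
    (B := (C + 1) * √(√(T * x))) (by omega) (fun l _ _ => (Real.exp_pos _).le)
    (fun l _ _ => ?_) (fun c h1 h2 => ?_)).trans_eq ?_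
  · apply Real.exp_le_exp.mpr
    gcongr
    linarith
  · have hbase : ∀ c, N + 1 ≤ c → c ≤ M → ‖∑ l ∈ Finset.Ico (N + 1) c, (-1 : ℂ) ^ l *
        Complex.exp (((β * √(x - (l : ℝ) ^ 2 / T) : ℝ) : ℂ) * Complex.I)‖ ≤ C * √(√(T * x)) := by
      intro c h1 h2
      refine h x T β (N + 1) c hT hx hTx hβ (by omega) h1 (lt_of_le_of_lt ?_ hM) (by push_cast; exact hN)
      gcongr
    -- The oscillation bound needs its excluded endpoint to satisfy b² < Tx, which M + 1 may
    -- violate. The term l = M is therefore split off, at the cost of the 1 in C + 1.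
    rcases Nat.lt_or_ge M c with h3 | h3
    · obtain rfl : c = M + 1 := by omega
      rw [Finset.sum_Ico_succ_top (by omega)]
      refine (norm_add_le _ _).trans ?_
      have h4 := hbase M (by omega) le_rfl
      rw [norm_mul, norm_pow, norm_neg, norm_one, one_pow, Complex.norm_exp_ofReal_mul_I]
      linarith
    · linarith [hbase c h1 h3]
  · push_cast; ring

/-- The cut `N` between the central and the outer part of the sum. -/
theorem exists_cut {L : ℝ} (hL : 200 ≤ L) :
    ∃ N : ℕ, Real.pi ^ 2 / (2 + Real.pi ^ 2) * L ^ 2 ≤ ((N : ℝ) + 1 / 2) ^ 2 ∧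
      ((N : ℝ) + 1 / 2) ^ 2 * (1 + (4 / 5 * Real.pi) ^ 2) ≤ (4 / 5 * Real.pi) ^ 2 * L ^ 2 := by
  have hp1 := Real.pi_gt_three
  have hp2 : Real.pi < 3.15 := Real.pi_lt_d2
  set P := Real.pi ^ 2 with hP
  have hP1 : 9 < P := by rw [hP]; nlinarith
  have hP2 : P < 10 := by rw [hP]; nlinarith
  set t := √(P / (2 + P)) with ht
  have et : t ^ 2 = P / (2 + P) := Real.sq_sqrt (by positivity)
  have ht0 : 0 ≤ t := Real.sqrt_nonneg _
  have ht1 : t ≤ 1 := by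
    apply le_of_sq_le_sq _ zero_le_one
    rw [et, one_pow, div_le_one (by positivity)]; linarith
  have ht2 : 1 / 2 ≤ t := by
    apply le_of_sq_le_sq _ ht0
    rw [et, le_div_iff₀ (by positivity)]; linarith
  have hpos : 0 ≤ t * L - 1 / 2 := by nlinarith
  refine ⟨⌈t * L - 1 / 2⌉₊, ?_, ?_⟩
  · rw [← et, ← mul_pow]
    have := Nat.le_ceil (t * L - 1 / 2)
    have h0 : 0 ≤ t * L := by positivity
    apply pow_le_pow_left₀ h0
    linarith
  · have h1 := Nat.ceil_lt_add_one hpos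
    set n := (⌈t * L - 1 / 2⌉₊ : ℝ) + 1 / 2 with hn
    have hn0 : 0 ≤ n := by positivity
    have h2 : n ≤ t * L + 1 := by linarith
    have h3 : n ^ 2 ≤ t ^ 2 * L ^ 2 + 2 * L + 1 := by
      have : n ^ 2 ≤ (t * L + 1) ^ 2 := pow_le_pow_left₀ hn0 h2 2
      nlinarith
    have h4 : 2 * L + 1 ≤ L ^ 2 / 50 := by nlinarith
    have e : (4 / 5 * Real.pi) ^ 2 = 16 / 25 * P := by rw [mul_pow, ← hP]; norm_num
    rw [e]
    -- The ideal cut has slope π/√2, and 4/5 > 1/√2 leaves room: the gap between the two fractions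
    -- exceeds 1/50, which absorbs the rounding error 2L + 1 once L ≥ 200.
    have h5 : (P / (2 + P) + 1 / 50) * (1 + 16 / 25 * P) ≤ 16 / 25 * P := by
      rw [div_add' _ _ _ (by positivity), div_mul_eq_mul_div, div_le_iff₀ (by positivity)]
      nlinarith
    calc n ^ 2 * (1 + 16 / 25 * P) ≤ (t ^ 2 * L ^ 2 + L ^ 2 / 50) * (1 + 16 / 25 * P) := by
          gcongr; linarith
      _ = L ^ 2 * ((P / (2 + P) + 1 / 50) * (1 + 16 / 25 * P)) := by rw [et]; ring
      _ ≤ L ^ 2 * (16 / 25 * P) := by gcongr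
      _ = _ := by ring

/-- The oscillating sum is `O(exp (α w √x) (T x) ^ (1 / 4))` with `w ^ 2 = 2 / (2 + π ^ 2)`. -/
theorem exists_norm_oscillatingSum_le {ε : ℝ} (hε : 0 < ε) :
    ∃ C R : ℝ, 0 < C ∧ 1 ≤ R ∧ ∀ x T α β : ℝ, R ≤ x → R ≤ T → 0 ≤ α → α < 1 + ε → |β| < √T →
      ‖oscillatingSum ((α : ℂ) + (β : ℂ) * Complex.I) x T‖ ≤
        C * (Real.exp (α * √(2 / (2 + Real.pi ^ 2)) * √x) * √(√(T * x))) := by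
  have hp1 := Real.pi_gt_three
  have hp2 : Real.pi < 3.15 := Real.pi_lt_d2
  obtain ⟨C₁, hC₁, hmid⟩ := exists_norm_central_sum_le (κ := 4 / 5 * Real.pi)
    (θ := 9 / 10 * Real.pi) (by positivity) (by linarith)
  obtain ⟨C₂, hC₂, hout⟩ := exists_norm_weighted_outer_sum_le
  -- The 200 serves the cut. The square forces 14(1 + ε) ≤ √T, so that α(1 + κ)/√T fits into the gap
  -- π/10 between κ = 4π/5 and θ = 9π/10. The factor 2 accounts for both signs of l.
  refine ⟨C₁ + 2 * C₂, 200 + (14 * (1 + ε)) ^ 2, by positivity,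
    by linarith [sq_nonneg (14 * (1 + ε))], ?_⟩
  intro x T α β hx hT hα hαε hβ
  have hR2 := sq_nonneg (14 * (1 + ε))
  have hx200 : 200 ≤ x := by linarith
  have hT200 : 200 ≤ T := by linarith
  have hT0 : 0 < T := by linarith
  have hTx : 200 ^ 2 ≤ T * x := by rw [sq]; gcongr
  set L := √(T * x) with hLdef
  have eL : L ^ 2 = T * x := Real.sq_sqrt (by positivity)
  have hL : 200 ≤ L := Real.le_sqrt_of_sq_le hTx
  have hsL : 1 ≤ √L := Real.one_le_sqrt.mpr (by linarith)
  have hsT : 14 * (1 + ε) ≤ √T := Real.le_sqrt_of_sq_le (by linarith)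
  have hsT0 : 0 < √T := Real.sqrt_pos.mpr hT0
  obtain ⟨N, hN1, hN2⟩ := exists_cut hL
  set n := (N : ℝ) + 1 / 2 with hn
  have hn0 : 0 < n := by positivity
  rw [eL] at hN1 hN2
  have hnL : n ^ 2 < T * x := by
    have : 0 < n ^ 2 := by positivity
    have h2 : 0 < (4 / 5 * Real.pi) ^ 2 := by positivity
    refine lt_of_mul_lt_mul_left ?_ h2.le
    linarith
  have hφ := sq_sqrt_sub_sq_div hT0 hnL
  set φ := √(x - n ^ 2 / T) with hφd
  have hφw : φ ≤ √(2 / (2 + Real.pi ^ 2)) * √x := by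
    rw [← Real.sqrt_mul (by positivity)]
    apply Real.sqrt_le_sqrt
    have h1 : Real.pi ^ 2 / (2 + Real.pi ^ 2) * x ≤ n ^ 2 / T := by
      rw [le_div_iff₀ hT0]; linarith
    have h2 : Real.pi ^ 2 / (2 + Real.pi ^ 2) = 1 - 2 / (2 + Real.pi ^ 2) := by
      field_simp; ring
    rw [h2] at h1
    linarith
  have hκ : n ≤ 4 / 5 * Real.pi * √T * φ := by
    apply le_of_sq_le_sq _ (by positivity)
    rw [mul_pow, mul_pow _ (√T), hφ.2, Real.sq_sqrt hT0.le]
    have : (4 / 5 * Real.pi) ^ 2 * T * (x - n ^ 2 / T)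
        = (4 / 5 * Real.pi) ^ 2 * (T * x) - (4 / 5 * Real.pi) ^ 2 * n ^ 2 := by
      field_simp
    linarith
  have hθ : α * (1 + 4 / 5 * Real.pi) / √T + 4 / 5 * Real.pi ≤ 9 / 10 * Real.pi := by
    have : α * (1 + 4 / 5 * Real.pi) / √T ≤ 1 / 10 * Real.pi := by
      rw [div_le_iff₀ hsT0]
      calc α * (1 + 4 / 5 * Real.pi) ≤ (1 + ε) * 4 := by gcongr; linarith
        _ ≤ 3 / 10 * √T := by linarith
        _ ≤ _ := by gcongr; linarith
    linarith
  have hNM : N ≤ ⌈L⌉₊ - 1 := by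
    have h1 : (N : ℝ) < L := by
      have : n < L := lt_of_pow_lt_pow_left₀ 2 (by linarith) (by rw [eL]; exact hnL)
      linarith
    have := Nat.lt_ceil.mpr h1
    omega
  have hM : (((⌈L⌉₊ - 1 : ℕ)) : ℝ) ^ 2 < T * x := by
    have h0 : 0 < ⌈L⌉₊ := Nat.ceil_pos.mpr (by linarith)
    have h1 : ((⌈L⌉₊ - 1 : ℕ) : ℝ) < L := Nat.lt_ceil.mp (by omega)
    rw [← eL]
    exact pow_lt_pow_left₀ h1 (by positivity) two_ne_zero
  have h4 : T * x / 4 ≤ ((N : ℝ) + 1) ^ 2 := by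
    have h1 : n ^ 2 ≤ ((N : ℝ) + 1) ^ 2 := by gcongr; linarith
    have h2 : 1 / 4 ≤ Real.pi ^ 2 / (2 + Real.pi ^ 2) := by
      have h3 : (3 : ℝ) ^ 2 ≤ Real.pi ^ 2 := by gcongr
      rw [div_le_div_iff₀ (by norm_num) (by positivity)]
      linarith
    calc T * x / 4 = 1 / 4 * (T * x) := by ring
      _ ≤ Real.pi ^ 2 / (2 + Real.pi ^ 2) * (T * x) := by gcongr
      _ ≤ _ := hN1.trans h1
  have b1 := hmid x T α β N hT0 hα hβ.le (by rw [← hφ.2]; exact pow_pos hφ.1 2) hκ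
    (by positivity) hθ
  have b2 := hout x T α β N (⌈L⌉₊ - 1) hT0 (by linarith) (by linarith) hα hβ.le hM h4
  have hE1 : Real.exp (α * φ) ≤ Real.exp (α * √(2 / (2 + Real.pi ^ 2)) * √x) := by
    apply Real.exp_le_exp.mpr
    rw [mul_assoc]; gcongr
  have hE2 : Real.exp (α * √(x - ((N : ℝ) + 1) ^ 2 / T)) ≤ Real.exp (α * √(2 / (2 + Real.pi ^ 2)) * √x) := by
    refine le_trans (Real.exp_le_exp.mpr ?_) hE1
    exact mul_le_mul_of_nonneg_left (sqrt_sub_sq_div_anti hT0 hn0.le (by linarith)) hα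
  have hsum : oscillatingSum ((α : ℂ) + (β : ℂ) * Complex.I) x T
      = ∑ l ∈ Finset.Icc (-(N : ℤ)) N, (-1 : ℂ) ^ l *
          Complex.exp (((α : ℂ) + (β : ℂ) * Complex.I) * (√(x - (l : ℝ) ^ 2 / T) : ℂ))
        + 2 * ∑ l ∈ Finset.Ico (N + 1) (⌈L⌉₊ - 1 + 1), (-1 : ℂ) ^ l *
          Complex.exp (((α : ℂ) + (β : ℂ) * Complex.I) * (√(x - (l : ℝ) ^ 2 / T) : ℂ)) := by
    rw [oscillatingSum, integersWithSqLT_eq_Icc (by linarith), ← hLdef, sum_Icc_neg_eq_of_even _ hNM]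
    · simp only [zpow_natCast, Int.cast_natCast]
    · intro l
      rw [zpow_neg, ← inv_zpow, inv_neg_one]
      simp
  rw [hsum]
  refine (norm_add_le _ _).trans ?_
  rw [norm_mul, Complex.norm_ofNat]
  set E := Real.exp (α * √(2 / (2 + Real.pi ^ 2)) * √x) with hE
  have hE0 : 0 < E := Real.exp_pos _
  have b1' : C₁ * Real.exp (α * φ) ≤ C₁ * (E * √L) := by
    gcongr
    exact hE1.trans (le_mul_of_one_le_right hE0.le hsL)
  have b2' : C₂ * (Real.exp (α * √(x - ((N : ℝ) + 1) ^ 2 / T)) * √L) ≤ C₂ * (E * √L) := by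
    gcongr
  linarith

/-! ### Absorbing (Tx)^(1/4) and conclusion -/

theorem sqrt_sqrt_le_exp {c x : ℝ} (hc : 0 < c) : √(√x) ≤ (1 + 1 / c) * Real.exp (c * √x) := by
  have hy := Real.sqrt_nonneg x
  set y := √x
  have h1 : √y ≤ 1 + y := by
    apply Real.sqrt_le_iff.mpr
    constructor <;> nlinarith
  have h2 := Real.add_one_le_exp (c * y)
  calc √y ≤ 1 + y := h1
    _ ≤ (1 + 1 / c) * (c * y + 1) := by
      have : (1 + 1 / c) * (c * y + 1) = 1 + y + c * y + 1 / c := by field_simp; ring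
      rw [this]
      have : 0 ≤ c * y + 1 / c := by positivity
      linarith
    _ ≤ _ := by gcongr

/-- Because |β| + 1 ≤ 2√T, the quotient T/(|β| + 1) is at least √T/2. -/
theorem sqrt_sqrt_le_sqrt_div {T β : ℝ} (hT : 1 ≤ T) (hβ : |β| < √T) :
    √(√T) ≤ √2 * √(T / (|β| + 1)) := by
  have hs : 1 ≤ √T := Real.one_le_sqrt.mpr hT
  have eT : √T ^ 2 = T := Real.sq_sqrt (by linarith)
  have hb := abs_nonneg β
  rw [← Real.sqrt_mul (by norm_num)]
  apply Real.sqrt_le_sqrt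
  rw [mul_div_assoc', le_div_iff₀ (by positivity)]
  nlinarith

theorem theorem2 (K ε δ α₀ : ℝ) (hK : 0 < K) (hε : 0 < ε) (hδ : 0 < δ) (hα₀ : 0 < α₀) :
    ∃ C R : ℝ, 0 < C ∧ 0 < R ∧
      ∀ x T α β : ℝ, R ≤ x → R ≤ T → x ^ 2 ≤ K * T →
        0 ≤ α → α < 1 + ε → |β| < Real.sqrt T →
          ((α = 0 ∨ α₀ ≤ α) →
            ‖oscillatingSum ((α : ℂ) + (β : ℂ) * Complex.I) x T‖ ≤
              C * (Real.sqrt (T / (|β| + 1)) *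
                  Real.exp (α * (Real.sqrt (2 / (2 + Real.pi ^ 2)) + δ) * Real.sqrt x)
                + Real.sqrt T)) ∧
          ‖oscillatingSum ((α : ℂ) + (β : ℂ) * Complex.I) x T‖ ≤
            C * (Real.sqrt (T / (|β| + 1)) *
                Real.exp ((α * Real.sqrt (2 / (2 + Real.pi ^ 2)) + δ) * Real.sqrt x)
              + Real.sqrt T) := by
  obtain ⟨C, R, hC, hR, h⟩ := exists_norm_oscillatingSum_le hε
  set w := √(2 / (2 + Real.pi ^ 2)) with hw
  -- Here c is the loss in the exponent that pays for x^(1/4), at the price of a factor 1 + 1/c. It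
  -- is taken as δ for the uniform bound and as α₀δ ≤ αδ when α ≥ α₀.
  have gen : ∀ c : ℝ, 0 < c → ∀ x T α β : ℝ, R ≤ x → R ≤ T → 0 ≤ α → α < 1 + ε → |β| < √T →
      ‖oscillatingSum ((α : ℂ) + (β : ℂ) * Complex.I) x T‖ ≤
        C * (√2 * (1 + 1 / c)) * (√(T / (|β| + 1)) * Real.exp ((α * w + c) * √x)) := by
    intro c hc x T α β hx hT hα hαε hβ
    refine (h x T α β hx hT hα hαε hβ).trans ?_
    have h1 := sqrt_sqrt_le_exp (x := x) hc
    have h2 := sqrt_sqrt_le_sqrt_div (hR.trans hT) hβ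
    rw [Real.sqrt_mul (by linarith), Real.sqrt_mul (Real.sqrt_nonneg _), add_mul, Real.exp_add]
    calc C * (Real.exp (α * w * √x) * (√(√T) * √(√x)))
        ≤ C * (Real.exp (α * w * √x) * ((√2 * √(T / (|β| + 1))) * ((1 + 1 / c) * Real.exp (c * √x)))) := by
          gcongr
      _ = _ := by ring
  have hαδ : 0 < α₀ * δ := by positivity
  set C₁ := C * (√2 * (1 + 1 / δ)) with hC₁
  set C₂ := C * (√2 * (1 + 1 / (α₀ * δ))) with hC₂
  set C₃ := C * √(√(√K)) with hC₃
  have p1 : 0 < C₁ := by positivity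
  have p2 : 0 < C₂ := by positivity
  have p3 : 0 < C₃ := by positivity
  refine ⟨C₁ + C₂ + C₃, R, by positivity, by linarith, ?_⟩
  intro x T α β hx hT hxT hα hαε hβ
  have hT1 : 1 ≤ T := hR.trans hT
  have hA : 0 ≤ √(T / (|β| + 1)) := Real.sqrt_nonneg _
  have hsT : 0 ≤ √T := Real.sqrt_nonneg _
  refine ⟨?_, ?_⟩
  · rintro (rfl | h0)
    · refine (h x T 0 β hx hT hα hαε hβ).trans ?_
      simp only [zero_mul, Real.exp_zero, one_mul, mul_one]
      -- At α = 0 no exponential can absorb x^(1/4). This is the one place where x² ≤ KT and the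
      -- summand √T are needed: x ≤ √K T gives (Tx)^(1/4) ≤ K^(1/8) √T.
      have h1 : √(√(T * x)) ≤ √(√(√K)) * √T := by
        rw [← Real.sqrt_mul (Real.sqrt_nonneg _)]
        apply Real.sqrt_le_sqrt
        apply Real.sqrt_le_iff.mpr
        refine ⟨by positivity, ?_⟩
        rw [mul_pow, Real.sq_sqrt (Real.sqrt_nonneg _)]
        have : x ≤ √K * T := by
          apply le_of_sq_le_sq _ (by positivity)
          rw [mul_pow, Real.sq_sqrt hK.le]
          refine hxT.trans ?_
          gcongr
          nlinarith
        nlinarith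
      calc C * √(√(T * x)) ≤ C * (√(√(√K)) * √T) := by gcongr
        _ = C₃ * √T := by rw [hC₃]; ring
        _ ≤ (C₁ + C₂ + C₃) * (√(T / (|β| + 1)) + √T) := by
          gcongr <;> linarith
    · refine (gen (α₀ * δ) hαδ x T α β hx hT hα hαε hβ).trans ?_
      have hexp : Real.exp ((α * w + α₀ * δ) * √x) ≤ Real.exp (α * (w + δ) * √x) := by
        apply Real.exp_le_exp.mpr
        rw [mul_add α]
        gcongr
      calc _ ≤ C₂ * (√(T / (|β| + 1)) * Real.exp (α * (w + δ) * √x)) := by gcongr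
        _ ≤ _ := by gcongr <;> linarith
  · refine (gen δ hδ x T α β hx hT hα hαε hβ).trans ?_
    gcongr <;> linarith
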